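/- Let $n\ge 2$. Let $(M^n,g)$ be a connected complete Riemannian manifold and let $(\overline M^{\,n+1},\bar g)$ be a semi-Riemannian manifold of constant sectional curvature $c$. Let $f\colon M\to\overline M$ be a smooth isometric immersion with a smooth unit normal field $N$ along $f$, $\bar g(N,N)=\epsilon_N\in\{1,-1\}$, and let $\mathcal A$ be its Weingarten operator, defined by $\overline\nabla_XN=-df(\mathcal AX)$. Let $\overline V$ be a smooth conformal vector field on $\overline M$ with smooth conformal factor $\sigma$, i.e. $\mathcal L_{\overline V}\bar g=2\sigma\bar g$, and suppose that its tangent part $V$, the vector field on $M$ with $g(V,Y)=\bar g(\overline V\circ f,df(Y))$ for all $Y$, defines on $M$ a Ricci almost soliton with soliton function $\lambda\colon M\to\mathbb R$, i.e. $$Ric+\tfrac12\mathcal L_Vg=\lambda g .$$ Suppose that $\psi=\sigma\circ f-\lambda$ is nonzero on a dense subset of $M$, and that $Ric=\mu\mathcal A$, i.e. $Ric(X,Y)=\mu\,g(\mathcal AX,Y)$ for all $X,Y$, for some smooth function $\mu$ on $M$. Then the angle function $C=\bar g(\overline V\circ f,N)$ is a special scalar concircular field on $(M,g)$: it is smooth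 and there are constants $k,b\in\mathbb R$ such that $$\mathrm{Hess}\,C=(-kC+b)\,g .$$ -/

import Mathlib

open Bundle
open scoped Manifold ContDiff

noncomputable section

namespace RicciSoliton

section Metric

variable {E : Type*} [NormedAddCommGroup E] [NormedSpace ℝ E]
  {H : Type*} [TopologicalSpace H]

/-- A field of (continuous) bilinear forms on the tangent spaces of a manifold. -/
abbrev BilinField (I : ModelWithCorners ℝ E H) (M : Type*) [TopologicalSpace M]
    [ChartedSpace H M] : Type _ :=
  (x : M) → TangentSpace I x →L[ℝ] TangentSpace I x →L[ℝ] ℝ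

/-- A bilinear form `b` has index `ν` when `ν` is the largest dimension of a subspace on which
`b` is negative definite. -/
def HasIndex {V : Type*} [AddCommGroup V] [Module ℝ V] (b : V → V → ℝ) (ν : ℕ) : Prop :=
  IsGreatest {k : ℕ | ∃ W : Submodule ℝ V, Module.finrank ℝ W = k ∧
    ∀ w ∈ W, w ≠ 0 → b w w < 0} ν

/-- A semi-Riemannian metric: a smooth field of symmetric nondegenerate bilinear forms of constant
index on the tangent spaces. -/
structure SemiRiemannianMetric (I : ModelWithCorners ℝ E H) (M : Type*) [TopologicalSpace M]
    [ChartedSpace H M] [IsManifold I ∞ M] where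
  val : BilinField I M
  symm : ∀ (x : M) (u v : TangentSpace I x), val x u v = val x v u
  nondegenerate : ∀ (x : M) (u : TangentSpace I x), (∀ v, val x u v = 0) → u = 0
  constIndex : ∃ ν : ℕ, ∀ x : M, HasIndex (fun u v : TangentSpace I x => val x u v) ν
  contMDiff : ContMDiff I (I.prod 𝓘(ℝ, E →L[ℝ] E →L[ℝ] ℝ)) ∞
    (fun x : M => TotalSpace.mk' (E →L[ℝ] E →L[ℝ] ℝ)
      (E := fun x : M => TangentSpace I x →L[ℝ] TangentSpace I x →L[ℝ] ℝ) x (val x))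

/-- The metric of a Riemannian manifold, as a field of bilinear forms. -/
def riemannianForm (I : ModelWithCorners ℝ E H) (M : Type*) [TopologicalSpace M]
    [ChartedSpace H M] [RiemannianBundle (fun x : M => TangentSpace I x)] : BilinField I M :=
  fun x => innerSL ℝ (E := TangentSpace I x)

end Metric

section Operators

variable {E : Type*} [NormedAddCommGroup E] [NormedSpace ℝ E]
  {H : Type*} [TopologicalSpace H] {I : ModelWithCorners ℝ E H}
  {M : Type*} [TopologicalSpace M] [ChartedSpace H M] [IsManifold I ∞ M]

/-- The smooth local extension of a tangent vector at `x` to a vector field (constant in the chart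
at `x`); it is linear in the vector. The tensors below do not depend on the extension. -/
def locExt {x : M} (u : TangentSpace I x) : (y : M) → TangentSpace I y :=
  FiberBundle.extend E u

/-- The metric dual at `x` of a linear form `φ`: the vector `w` with `g(w, ·) = φ`. -/
def sharp (g : BilinField I M) (x : M) (φ : TangentSpace I x → ℝ) : TangentSpace I x :=
  Classical.epsilon fun w => ∀ v, g x w v = φ v

/-- The right-hand side of the Koszul formula for `g(∇_X Y, Z)`. -/
def koszul (g : BilinField I M) (X Y Z : (x : M) → TangentSpace I x) (x : M) : ℝ :=
  (1 / 2 : ℝ) *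
    (mvfderiv I (fun y => g y (Y y) (Z y)) x (X x)
      + mvfderiv I (fun y => g y (X y) (Z y)) x (Y x)
      - mvfderiv I (fun y => g y (X y) (Y y)) x (Z x)
      + g x (VectorField.mlieBracket I X Y x) (Z x)
      - g x (VectorField.mlieBracket I X Z x) (Y x)
      - g x (VectorField.mlieBracket I Y Z x) (X x))

/-- The Levi-Civita connection `∇_X Y` of `g`, determined by the Koszul formula. -/
def leviCivita (g : BilinField I M) (X Y : (x : M) → TangentSpace I x) :
    (x : M) → TangentSpace I x :=
  fun x => sharp g x fun v => koszul g X Y (locExt v) x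

/-- The curvature `R(u, v) w` for `R(X, Y) Z = ∇_X ∇_Y Z - ∇_Y ∇_X Z - ∇_[X,Y] Z`. -/
def curvature (g : BilinField I M) (x : M) (u v w : TangentSpace I x) : TangentSpace I x :=
  leviCivita g (locExt u) (leviCivita g (locExt v) (locExt w)) x
    - leviCivita g (locExt v) (leviCivita g (locExt u) (locExt w)) x
    - leviCivita g (VectorField.mlieBracket I (locExt u) (locExt v)) (locExt w) x

/-- `g(u, u) g(v, v) - g(u, v) ^ 2`; the plane spanned by `u`, `v` is nondegenerate iff this is
nonzero. -/
def areaForm (g : BilinField I M) (x : M) (u v : TangentSpace I x) : ℝ :=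
  g x u u * g x v v - g x u v ^ 2

/-- The sectional curvature of the nondegenerate plane spanned by `u` and `v`. -/
def sectionalCurvature (g : BilinField I M) (x : M) (u v : TangentSpace I x) : ℝ :=
  g x (curvature g x u v v) u / areaForm g x u v

/-- All nondegenerate tangent planes have sectional curvature `c`. -/
def HasConstantSectionalCurvature (g : BilinField I M) (c : ℝ) : Prop :=
  ∀ (x : M) (u v : TangentSpace I x), areaForm g x u v ≠ 0 → sectionalCurvature g x u v = c

/-- The Ricci tensor `Ric(u, v)`, the trace of `w ↦ R(w, u) v`. -/
def ricci [FiniteDimensional ℝ E] (g : BilinField I M) (x : M) (u v : TangentSpace I x) : ℝ :=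
  haveI : FiniteDimensional ℝ (TangentSpace I x) := inferInstanceAs (FiniteDimensional ℝ E)
  letI b := Module.finBasis ℝ (TangentSpace I x)
  ∑ i, b.repr (curvature g x (b i) u v) i

/-- The Lie derivative `(L_X g)(u, v)`, where
`(L_X g)(Y, Z) = X g(Y, Z) - g([X, Y], Z) - g(Y, [X, Z])`. -/
def lieDerivMetric (g : BilinField I M) (X : (x : M) → TangentSpace I x) (x : M)
    (u v : TangentSpace I x) : ℝ :=
  mvfderiv I (fun y => g y (locExt u y) (locExt v y)) x (X x)
    - g x (VectorField.mlieBracket I X (locExt u) x) v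
    - g x u (VectorField.mlieBracket I X (locExt v) x)

/-- The gradient of a function. -/
def grad (g : BilinField I M) (h : M → ℝ) : (x : M) → TangentSpace I x :=
  fun x => sharp g x fun v => mvfderiv I h x v

/-- The Hessian `Hess h (u, v) = g(∇_u grad h, v)`. -/
def hess (g : BilinField I M) (h : M → ℝ) (x : M) (u v : TangentSpace I x) : ℝ :=
  g x (leviCivita g (locExt u) (grad g h) x) v

/-- A smooth vector field. -/
def IsSmoothField (X : (x : M) → TangentSpace I x) : Prop :=
  ContMDiff I I.tangent ∞ fun x => (⟨x, X x⟩ : TangentBundle I M)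

/-- `X` is a smooth conformal vector field with smooth conformal factor `σ`: `L_X g = 2 σ g`. -/
structure IsConformalField (g : BilinField I M) (X : (x : M) → TangentSpace I x) (σ : M → ℝ) :
    Prop where
  smooth_field : IsSmoothField X
  smooth_factor : ContMDiff I 𝓘(ℝ, ℝ) ∞ σ
  lieDeriv_eq : ∀ (x : M) (u v : TangentSpace I x),
    lieDerivMetric g X x u v = 2 * σ x * g x u v

/-- `X` defines on `(M, g)` the structure of a Ricci almost soliton with soliton function `lam`:
`Ric + (1/2) L_X g = lam g`. -/
structure IsRicciAlmostSoliton [FiniteDimensional ℝ E] (g : BilinField I M)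
    (X : (x : M) → TangentSpace I x) (lam : M → ℝ) : Prop where
  smooth_field : IsSmoothField X
  soliton_eq : ∀ (x : M) (u v : TangentSpace I x),
    ricci g x u v + (1 / 2 : ℝ) * lieDerivMetric g X x u v = lam x * g x u v

/-- `ρ` is a special scalar concircular field: `ρ` is smooth and `Hess ρ = (-k ρ + b) g` for some
constants `k` and `b`. -/
def IsSpecialScalarConcircular (g : BilinField I M) (ρ : M → ℝ) : Prop :=
  ContMDiff I 𝓘(ℝ, ℝ) ∞ ρ ∧
    ∃ k b : ℝ, ∀ (x : M) (u v : TangentSpace I x),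
      hess g ρ x u v = (-k * ρ x + b) * g x u v

end Operators

section Immersion

variable {E : Type*} [NormedAddCommGroup E] [NormedSpace ℝ E]
  {H : Type*} [TopologicalSpace H] {I : ModelWithCorners ℝ E H}
  {M : Type*} [TopologicalSpace M] [ChartedSpace H M] [IsManifold I ∞ M]
  {E' : Type*} [NormedAddCommGroup E'] [NormedSpace ℝ E']
  {H' : Type*} [TopologicalSpace H'] {I' : ModelWithCorners ℝ E' H'}
  {M' : Type*} [TopologicalSpace M'] [ChartedSpace H' M'] [IsManifold I' ∞ M']

/-- `f` is an isometric immersion of `(M, g)` into `(M', g')`: `f` is smooth and `f^* g' = g`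
(so that `df` is injective if `g` is nondegenerate). -/
structure IsIsometricImmersion (g : BilinField I M) (g' : BilinField I' M') (f : M → M') :
    Prop where
  smooth : ContMDiff I I' ∞ f
  isometric : ∀ (x : M) (u v : TangentSpace I x),
    g' (f x) (mfderiv I I' f x u) (mfderiv I I' f x v) = g x u v

/-- `N` is a smooth unit normal field along the immersion `f`, with `g'(N, N) = ε = ± 1`. -/
structure IsUnitNormal (g' : BilinField I' M') (f : M → M')
    (N : (x : M) → TangentSpace I' (f x)) (ε : ℝ) : Prop where
  smooth : ContMDiff I I'.tangent ∞ fun x => (⟨f x, N x⟩ : TangentBundle I' M')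
  sign : ε = 1 ∨ ε = -1
  unit : ∀ x, g' (f x) (N x) (N x) = ε
  normal : ∀ (x : M) (u : TangentSpace I x), g' (f x) (N x) (mfderiv I I' f x u) = 0

/-- The covariant derivative `∇'_u W` at `x` of a vector field `W` along `f` (the pull-back of the
Levi-Civita connection of `g'`): in the trivialization `t` of `TM'` around `f x` one has
`W y = t.symm (f y) (w y)`, and
`∇'_u W = t.symm (f x) (dw(u)) + ∇'_{df(u)} (t.symm · (w x))`. -/
def covDerivAlong (g' : BilinField I' M') (f : M → M') (W : (x : M) → TangentSpace I' (f x))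
    (x : M) (u : TangentSpace I x) : TangentSpace I' (f x) :=
  letI t := trivializationAt E' (TangentSpace I' : M' → Type _) (f x)
  t.symm (f x)
      (mvfderiv I (fun y => (t (⟨f y, W y⟩ : TangentBundle I' M')).2) x u)
    + leviCivita g' (locExt (mfderiv I I' f x u)) (locExt (W x)) (f x)

/-- The Weingarten operator: `𝒜 u` is the tangent vector with `df(𝒜 u) = - ∇'_u N`. -/
def weingarten (g' : BilinField I' M') (f : M → M') (N : (x : M) → TangentSpace I' (f x))
    (x : M) (u : TangentSpace I x) : TangentSpace I x :=
  Function.invFun (mfderiv I I' f x) (-covDerivAlong g' f N x u)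

/-- The tangent part of a vector field `X` of `M'` along `f`: the vector field `V` of `M` with
`g(V, v) = g'(X, df(v))` for all `v`. -/
def tangentPart (g : BilinField I M) (g' : BilinField I' M') (f : M → M')
    (X : (y : M') → TangentSpace I' y) : (x : M) → TangentSpace I x :=
  fun x => sharp g x fun v => g' (f x) (X (f x)) (mfderiv I I' f x v)

/-- The angle function `C = g'(X, N)`. -/
def angle (g' : BilinField I' M') (f : M → M') (N : (x : M) → TangentSpace I' (f x))
    (X : (y : M') → TangentSpace I' y) : M → ℝ :=
  fun x => g' (f x) (X (f x)) (N x)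

end Immersion

end RicciSoliton

end

/-! Write S(u, v) = g'(∇'_u N, df v) = -g(𝒜u, v). Decomposing the conformal field along f as df(V) +
εC N and taking the tangential part of its covariant derivative gives ½ L_V g = σ g - εC S
(`lieDerivMetric_tangentPart`). With Ric = -μ S, the soliton equation becomes (μ + εC) S = ψ g. Thus
S is proportional to g wherever ψ ≠ 0. The identity S(u, v) g(w, w) = S(w, w) g(u, v) expresses this
without division, and it extends from the dense set to all of M by continuity (`shapeForm_mul_eq`).
So M is totally umbilic: 𝒜 = α Id.

The ambient curvature tensor along f is the constant curvature one, so the Codazzi equation and n ≥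
2 force dα = 0. Connectedness then makes α a constant a (`exists_umbilic_const`), and the Gauss
equation gives M constant curvature k = c + εa² (`curvature_of_umbilic`).

For a conformal field X, the second covariant derivative is determined by dσ and the curvature, by
the same linear algebra that produces the Christoffel symbols (`IsLocalConformal.covDeriv₂_eq`).
Differentiating C = g'(X, N) twice along the umbilic hypersurface therefore yields Hess C = φ g with
φ = -(dσ(N) + aσ + kC) (`hess_angle`). The function dσ(N) need not be analysed further: since ∇ grad
C = φ Id, the Ricci identity in constant curvature k gives dφ = -k dC
(`fderiv_of_covDeriv_eq_smul`), so φ + kC is a constant b.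

The differential geometry is done on open subsets of vector spaces, for a metric G with Christoffel
symbols Γ. The chart sections show that the invariantly defined objects have the expected coordinate
expressions, at every point of a chart when they must be differentiated again. -/

namespace RicciSoliton

set_option maxSynthPendingDepth 3
set_option linter.unusedSectionVars false

/-! ### Algebraic curvature tensors. -/

section Polarization

/-- A curvature-like quadrilinear form with vanishing sectional curvature is zero. -/
theorem curvatureLike_eq_zero {V : Type*} [AddCommGroup V] (P : V → V → V → V → ℝ)
    (add₁ : ∀ a b u v w, P (a + b) u v w = P a u v w + P b u v w)
    (add₄ : ∀ a b u v w, P u v w (a + b) = P u v w a + P u v w b)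
    (add₂ : ∀ a b u v w, P u (a + b) v w = P u a v w + P u b v w)
    (add₃ : ∀ a b u v w, P u v (a + b) w = P u v a w + P u v b w)
    (skew₁ : ∀ u v w x, P u v w x = -P v u w x)
    (skew₂ : ∀ u v w x, P u v w x = -P u v x w)
    (bianchi : ∀ u v w x, P u v w x + P v w u x + P w u v x = 0)
    (sec : ∀ u v, P u v v u = 0) (u v w x : V) : P u v w x = 0 := by
  -- Pair symmetry comes from adding the four Bianchi identities obtained by cycling the arguments,
  -- modulo the two skew symmetries.
  have pair : ∀ u v w x, P u v w x = P w x u v := by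
    intro u v w x
    have h1 := bianchi u v w x
    have h2 := bianchi v w x u
    have h3 := bianchi w x u v
    have h4 := bianchi x u v w
    have := skew₁ u v w x
    linarith [skew₁ u v w x, skew₂ u v w x, skew₁ v w u x, skew₂ v w u x, skew₁ w u v x,
      skew₂ w u v x, skew₁ w x v u, skew₂ w x v u, skew₁ x v w u, skew₂ x v w u,
      skew₁ x u w v, skew₂ x u w v, skew₁ u w x v, skew₂ u w x v, skew₁ v x u w,
      skew₂ u v x w, skew₂ w x u v, skew₂ v x u w, skew₁ x u v w, skew₂ x u v w, skew₂ v w x u]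
  have mid : ∀ u v x, P u v v x = 0 := by
    intro u v x
    have h := sec (u + x) v
    rw [add₁, add₄, add₄, sec, sec] at h
    have h1 : P x v v u = P u v v x := by
      rw [pair x v v u, skew₁, skew₂]; ring
    linarith
  -- A second polarization, now in the middle slots. Skewness in all adjacent slots turns the
  -- Bianchi identity into 3P = 0.
  have skew₃ : ∀ u v w x, P u v w x = -P u w v x := by
    intro u v w x
    have h := mid u (v + w) x
    rw [add₂, add₃, add₃, mid, mid] at h
    linarith
  have h := bianchi u v w x
  have h1 : P v w u x = P u v w x := by rw [skew₃, skew₁]; ring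
  have h2 : P w u v x = P u v w x := by rw [skew₁, skew₃]; ring
  linarith

end Polarization

theorem minSmoothness_two_le_infty : minSmoothness ℝ 2 ≤ (∞ : WithTop ℕ∞) := by
  rw [minSmoothness_of_isRCLikeNormedField]
  exact WithTop.coe_le_coe.2 le_top

theorem fderiv_clm_apply₂ {D E F K : Type*} [NormedAddCommGroup D] [NormedSpace ℝ D]
    [NormedAddCommGroup E] [NormedSpace ℝ E] [NormedAddCommGroup F] [NormedSpace ℝ F]
    [NormedAddCommGroup K] [NormedSpace ℝ K] {B : D → E →L[ℝ] F →L[ℝ] K} {z : D}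
    (hB : DifferentiableAt ℝ B z) (u : D) (a : E) (b : F) :
    fderiv ℝ (fun y => B y a b) z u = fderiv ℝ B z u a b := by
  have h := (hB.hasFDerivAt.clm_apply (hasFDerivAt_const a z)).clm_apply (hasFDerivAt_const b z)
  rw [h.fderiv]
  simp

/-! ### Levi-Civita connection and curvature in coordinates. -/

section LocalMetric

variable {E : Type*} [NormedAddCommGroup E] [NormedSpace ℝ E]

/-- A smooth nondegenerate symmetric bilinear form on an open subset of a vector space. -/
structure IsLocalMetric (G : E → E →L[ℝ] E →L[ℝ] ℝ) (U : Set E) : Prop where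
  isOpen : IsOpen U
  contDiffOn : ContDiffOn ℝ ∞ G U
  symm : ∀ z ∈ U, ∀ u v, G z u v = G z v u
  nondegenerate : ∀ z ∈ U, ∀ u, (∀ v, G z u v = 0) → u = 0

/-- The Christoffel symbols of the first kind. -/
noncomputable def christoffelFirst (G : E → E →L[ℝ] E →L[ℝ] ℝ) (z : E) :
    E →L[ℝ] E →L[ℝ] E →L[ℝ] ℝ :=
  (1 / 2 : ℝ) • (fderiv ℝ G z + (fderiv ℝ G z).flip
    - ((ContinuousLinearMap.flipₗᵢ ℝ E E ℝ).toContinuousLinearEquiv :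
        (E →L[ℝ] E →L[ℝ] ℝ) →L[ℝ] (E →L[ℝ] E →L[ℝ] ℝ)) ∘L (fderiv ℝ G z).flip)

/-- The Christoffel symbols: `Γ(u, v)` is the covariant derivative of the constant field `v` in the
direction `u`. -/
noncomputable def christoffel (G : E → E →L[ℝ] E →L[ℝ] ℝ) (z : E) : E →L[ℝ] E →L[ℝ] E :=
  (ContinuousLinearMap.compL ℝ E (E →L[ℝ] ℝ) E (G z).inverse) ∘L christoffelFirst G z

/-- The curvature of a connection with Christoffel symbols `Γ`. -/
noncomputable def curvatureOf (Γ : E → E →L[ℝ] E →L[ℝ] E) (z u v w : E) : E :=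
  fderiv ℝ Γ z u v w - fderiv ℝ Γ z v u w + Γ z u (Γ z v w) - Γ z v (Γ z u w)

theorem christoffelFirst_apply (G : E → E →L[ℝ] E →L[ℝ] ℝ) (z u v w : E) :
    christoffelFirst G z u v w =
      (1 / 2 : ℝ) * (fderiv ℝ G z u v w + fderiv ℝ G z v u w - fderiv ℝ G z w u v) := by
  simp [christoffelFirst]

namespace IsLocalMetric

variable {G : E → E →L[ℝ] E →L[ℝ] ℝ} {U : Set E} {z : E}

theorem contDiffAt (hG : IsLocalMetric G U) (hz : z ∈ U) : ContDiffAt ℝ ∞ G z :=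
  (hG.contDiffOn z hz).contDiffAt (hG.isOpen.mem_nhds hz)

theorem differentiableAt (hG : IsLocalMetric G U) (hz : z ∈ U) : DifferentiableAt ℝ G z :=
  (hG.contDiffAt hz).differentiableAt (by simp)

theorem eventually_mem (hG : IsLocalMetric G U) (hz : z ∈ U) : ∀ᶠ y in nhds z, y ∈ U :=
  hG.isOpen.mem_nhds hz

theorem eq_of_forall (hG : IsLocalMetric G U) (hz : z ∈ U) {u v : E}
    (h : ∀ w, G z u w = G z v w) : u = v :=
  sub_eq_zero.1 (hG.nondegenerate z hz _ fun w => by simp [h w])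

theorem fderiv_symm (hG : IsLocalMetric G U) (hz : z ∈ U) (u v w : E) :
    fderiv ℝ G z u v w = fderiv ℝ G z u w v := by
  rw [← fderiv_clm_apply₂ (hG.differentiableAt hz), ← fderiv_clm_apply₂ (hG.differentiableAt hz)]
  refine DFunLike.congr_fun (Filter.EventuallyEq.fderiv_eq ?_) u
  filter_upwards [hG.eventually_mem hz] with y hy using hG.symm y hy v w

variable [FiniteDimensional ℝ E]

/-- Nondegeneracy is injectivity, and E and its dual have equal dimension. Hence the total function
`ContinuousLinearMap.inverse` is a genuine inverse at z and depends smoothly on the metric there. -/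
theorem exists_equiv (hG : IsLocalMetric G U) (hz : z ∈ U) :
    ∃ e : E ≃L[ℝ] (E →L[ℝ] ℝ), (e : E →L[ℝ] (E →L[ℝ] ℝ)) = G z := by
  have hinj : Function.Injective (G z : E →ₗ[ℝ] (E →L[ℝ] ℝ)) := by
    rw [← LinearMap.ker_eq_bot, LinearMap.ker_eq_bot']
    intro m hm
    exact hG.nondegenerate z hz m fun v => by
      have : G z m = 0 := hm
      simp [this]
  have hfr : Module.finrank ℝ E = Module.finrank ℝ (E →L[ℝ] ℝ) := by
    rw [← LinearEquiv.finrank_eq (LinearMap.toContinuousLinearMap : (E →ₗ[ℝ] ℝ) ≃ₗ[ℝ] _)]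
    exact (Subspace.dual_finrank_eq (K := ℝ) (V := E)).symm
  refine ⟨(LinearEquiv.ofInjectiveOfFinrankEq _ hinj hfr).toContinuousLinearEquiv, ?_⟩
  ext u v
  rfl

theorem apply_inverse (hG : IsLocalMetric G U) (hz : z ∈ U) (φ : E →L[ℝ] ℝ) :
    G z ((G z).inverse φ) = φ := by
  obtain ⟨e, he⟩ := hG.exists_equiv hz
  rw [← he, ContinuousLinearMap.inverse_equiv]
  simp

theorem contDiffAt_inverse (hG : IsLocalMetric G U) (hz : z ∈ U) :
    ContDiffAt ℝ ∞ (fun y => (G y).inverse) z := by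
  obtain ⟨e, he⟩ := hG.exists_equiv hz
  have h := contDiffAt_map_inverse (n := ∞) e
  rw [he] at h
  exact h.comp z (hG.contDiffAt hz)

theorem apply_christoffel (hG : IsLocalMetric G U) (hz : z ∈ U) (u v w : E) :
    G z (christoffel G z u v) w =
      (1 / 2 : ℝ) * (fderiv ℝ G z u v w + fderiv ℝ G z v u w - fderiv ℝ G z w u v) := by
  rw [← christoffelFirst_apply]
  simp [christoffel, hG.apply_inverse hz]

theorem christoffel_symm (hG : IsLocalMetric G U) (hz : z ∈ U) (u v : E) :
    christoffel G z u v = christoffel G z v u := by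
  refine hG.eq_of_forall hz fun w => ?_
  rw [hG.apply_christoffel hz, hG.apply_christoffel hz, hG.fderiv_symm hz w u v]
  ring

/-- Metric compatibility of Γ. Together with `christoffel_symm` (vanishing torsion), it does the
work of the Koszul formula in later computations. -/
theorem fderiv_eq (hG : IsLocalMetric G U) (hz : z ∈ U) (u v w : E) :
    fderiv ℝ G z u v w = G z (christoffel G z u v) w + G z v (christoffel G z u w) := by
  rw [hG.symm z hz v, hG.apply_christoffel hz, hG.apply_christoffel hz, hG.fderiv_symm hz w u v,
    hG.fderiv_symm hz v u w, hG.fderiv_symm hz u v w]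
  ring

theorem contDiffAt_christoffel (hG : IsLocalMetric G U) (hz : z ∈ U) :
    ContDiffAt ℝ ∞ (christoffel G) z := by
  have h1 : ContDiffAt ℝ ∞ (fderiv ℝ G) z := (hG.contDiffAt hz).fderiv_right (by simp)
  have h2 : ContDiffAt ℝ ∞ (fun y => (fderiv ℝ G y).flip) z :=
    (ContinuousLinearMap.flipₗᵢ ℝ E E (E →L[ℝ] ℝ)).toContinuousLinearEquiv.contDiff.contDiffAt.comp
      z h1
  have h3 : ContDiffAt ℝ ∞ (christoffelFirst G) z := by
    unfold christoffelFirst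
    exact ((h1.add h2).sub (contDiffAt_const.clm_comp h2)).const_smul (1 / 2 : ℝ)
  exact ((ContinuousLinearMap.compL ℝ E (E →L[ℝ] ℝ) E).contDiff.contDiffAt.comp z
    (hG.contDiffAt_inverse hz)).clm_comp h3

theorem differentiableAt_christoffel (hG : IsLocalMetric G U) (hz : z ∈ U) :
    DifferentiableAt ℝ (christoffel G) z :=
  (hG.contDiffAt_christoffel hz).differentiableAt (by simp)

/-- Symmetry of Γ holds near z, hence passes to its derivative; the terms of the cyclic sum then
cancel in pairs. -/
theorem curvature_bianchi (hG : IsLocalMetric G U) (hz : z ∈ U) (u v w : E) :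
    curvatureOf (christoffel G) z u v w + curvatureOf (christoffel G) z v w u
      + curvatureOf (christoffel G) z w u v = 0 := by
  have hd : ∀ a b c, fderiv ℝ (christoffel G) z a b c = fderiv ℝ (christoffel G) z a c b := by
    intro a b c
    rw [← fderiv_clm_apply₂ (hG.differentiableAt_christoffel hz),
      ← fderiv_clm_apply₂ (hG.differentiableAt_christoffel hz)]
    refine DFunLike.congr_fun (Filter.EventuallyEq.fderiv_eq ?_) a
    filter_upwards [hG.eventually_mem hz] with y hy using hG.christoffel_symm hy b c
  simp only [curvatureOf]
  rw [hd u v w, hd w v u, hd v u w, hG.christoffel_symm hz v w, hG.christoffel_symm hz u w,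
    hG.christoffel_symm hz u v]
  abel

/-- Differentiate metric compatibility once more and antisymmetrize in u, v. The second derivative
of G disappears by Schwarz, the mixed products G(Γw, Γx) cancel, and what is left is the claim. -/
theorem curvature_skew (hG : IsLocalMetric G U) (hz : z ∈ U) (u v w x : E) :
    G z (curvatureOf (christoffel G) z u v w) x
      = -G z (curvatureOf (christoffel G) z u v x) w := by
  have hdG := (hG.differentiableAt hz).hasFDerivAt
  have hdΓ := (hG.differentiableAt_christoffel hz).hasFDerivAt
  have key : ∀ a b, fderiv ℝ (fderiv ℝ G) z a b w x =
      fderiv ℝ G z a (christoffel G z b w) x + G z (fderiv ℝ (christoffel G) z a b w) x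
      + fderiv ℝ G z a w (christoffel G z b x) + G z w (fderiv ℝ (christoffel G) z a b x) := by
    intro a b
    have hd2 : HasFDerivAt (fderiv ℝ G) (fderiv ℝ (fderiv ℝ G) z) z :=
      (((hG.contDiffAt hz).fderiv_right (m := 1) (by norm_cast)).differentiableAt
        (by simp)).hasFDerivAt
    have h1 := ((hd2.clm_apply (hasFDerivAt_const b z)).clm_apply
      (hasFDerivAt_const w z)).clm_apply (hasFDerivAt_const x z)
    have hΓ : ∀ c, HasFDerivAt (fun y => christoffel G y b c) _ z := fun c =>
      (hdΓ.clm_apply (hasFDerivAt_const b z)).clm_apply (hasFDerivAt_const c z)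
    have h2 := ((hdG.clm_apply (hΓ w)).clm_apply (hasFDerivAt_const x z)).add
      ((hdG.clm_apply (hasFDerivAt_const w z)).clm_apply (hΓ x))
    have h3 := h1.unique (h2.congr_of_eventuallyEq (by
      filter_upwards [hG.eventually_mem hz] with y hy
      simpa using hG.fderiv_eq hy b w x))
    have h4 := DFunLike.congr_fun h3 a
    simp at h4
    linarith
  have hs : IsSymmSndFDerivAt ℝ G z :=
    (hG.contDiffAt hz).isSymmSndFDerivAt minSmoothness_two_le_infty
  have h5 := key u v
  have h6 := key v u
  rw [hs v u] at h6
  simp only [hG.fderiv_eq hz] at h5 h6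
  rw [hG.symm z hz _ w]
  simp only [curvatureOf, map_add, map_sub, add_apply,
    sub_apply]
  linarith

/-- A metric of constant sectional curvature `c` has the curvature tensor
`R(u, v) w = c (g(v, w) u - g(u, w) v)`. -/
theorem curvature_eq_of_sectional (hG : IsLocalMetric G U) (hz : z ∈ U) {c : ℝ} {u₀ v₀ : E}
    (h₀ : G z u₀ u₀ * G z v₀ v₀ - G z u₀ v₀ ^ 2 ≠ 0)
    (hc : ∀ u v, G z u u * G z v v - G z u v ^ 2 ≠ 0 →
      G z (curvatureOf (christoffel G) z u v v) u = c * (G z u u * G z v v - G z u v ^ 2))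
    (u v w : E) :
    curvatureOf (christoffel G) z u v w = c • (G z v w • u - G z u w • v) := by
  have sec : ∀ u v, G z (curvatureOf (christoffel G) z u v v) u
      = c * (G z u u * G z v v - G z u v ^ 2) := by
    intro u v
    -- A degenerate plane is approached by the planes of u + t u₀, v + t v₀. Their area form is a
    -- polynomial in t that vanishes only finitely often, so the identity extends to t = 0 by
    -- continuity.
    let a : ℝ → ℝ := fun t => G z (u + t • u₀) (u + t • u₀) * G z (v + t • v₀) (v + t • v₀)
      - G z (u + t • u₀) (v + t • v₀) ^ 2
    let q : ℝ → ℝ := fun t =>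
      G z (curvatureOf (christoffel G) z (u + t • u₀) (v + t • v₀) (v + t • v₀)) (u + t • u₀)
        - c * a t
    have hq : Continuous q := by
      simp only [q, a, curvatureOf]
      fun_prop
    have hfin : {t | a t = 0}.Finite := by
      let p : Polynomial ℝ :=
        (.C (G z u u) + .C (2 * G z u u₀) * .X + .C (G z u₀ u₀) * .X ^ 2) *
        (.C (G z v v) + .C (2 * G z v v₀) * .X + .C (G z v₀ v₀) * .X ^ 2) -
        (.C (G z u v) + .C (G z u v₀ + G z u₀ v) * .X + .C (G z u₀ v₀) * .X ^ 2) ^ 2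
      have hp : ∀ t, p.eval t = a t := by
        intro t
        simp [p, a, hG.symm z hz u₀ u, hG.symm z hz v₀ v]
        ring
      have hp0 : p ≠ 0 := by
        intro h
        refine h₀ ?_
        -- The leading coefficient is the area form of the given nondegenerate plane, so p is not
        -- the zero polynomial.
        have h4 : p.coeff 4 = G z u₀ u₀ * G z v₀ v₀ - G z u₀ v₀ ^ 2 := by
          have hpe : p = .C (G z u u * G z v v - G z u v ^ 2)
            + .C (2 * G z u u₀ * G z v v + G z u u * (2 * G z v v₀)
              - 2 * G z u v * (G z u v₀ + G z u₀ v)) * .X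
            + .C (G z u u * G z v₀ v₀ + G z u₀ u₀ * G z v v + 4 * G z u u₀ * G z v v₀
              - (G z u v₀ + G z u₀ v) ^ 2 - 2 * G z u v * G z u₀ v₀) * .X ^ 2
            + .C (2 * G z u u₀ * G z v₀ v₀ + G z u₀ u₀ * (2 * G z v v₀)
              - 2 * G z u₀ v₀ * (G z u v₀ + G z u₀ v)) * .X ^ 3
            + .C (G z u₀ u₀ * G z v₀ v₀ - G z u₀ v₀ ^ 2) * .X ^ 4 := by
            simp only [p, map_mul, map_add, map_sub, map_pow, map_ofNat]
            ring
          rw [hpe]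
          simp only [Polynomial.coeff_add, Polynomial.coeff_C_mul, Polynomial.coeff_X_pow,
            Polynomial.coeff_X, Polynomial.coeff_C]
          norm_num
        rw [← h4, h, Polynomial.coeff_zero]
      refine (p.roots.toFinset.finite_toSet).subset fun t ht => ?_
      simpa [hp0, hp] using ht
    have hdense : Dense {t | a t = 0}ᶜ := hfin.countable.dense_compl ℝ
    have hzero : q = fun _ => 0 := by
      refine Continuous.ext_on hdense hq continuous_const fun t ht => ?_
      simp only [q]
      rw [hc _ _ ht, sub_self]
    have := congrFun hzero 0
    simp only [q, a, zero_smul, add_zero] at this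
    linarith
  refine hG.eq_of_forall hz fun x => ?_
  -- The difference between the curvature and the constant curvature model is curvature-like and has
  -- zero sectional curvature.
  have h := curvatureLike_eq_zero (fun u v w x => G z (curvatureOf (christoffel G) z u v w) x
    - c * (G z v w * G z u x - G z u w * G z v x)) (fun a b u v w => ?_) (fun a b u v w => ?_)
    (fun a b u v w => ?_) (fun a b u v w => ?_) (fun u v w x => ?_) (fun u v w x => ?_)
    (fun u v w x => ?_) (fun u v => ?_) u v w x
  · simp only [map_smul, map_sub, sub_apply, smul_apply,
      smul_eq_mul]
    linarith
  · simp only [curvatureOf, map_add, map_sub, add_apply, sub_apply]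
    ring
  · simp only [curvatureOf, map_add, map_sub, add_apply, sub_apply]
    ring
  · simp only [curvatureOf, map_add, map_sub, add_apply, sub_apply]
    ring
  · simp only [curvatureOf, map_add, map_sub, add_apply, sub_apply]
    ring
  · simp only [curvatureOf, map_add, map_sub, add_apply, sub_apply]
    ring
  · simp only [hG.curvature_skew hz u v w x]
    ring
  · have := congrArg (fun y => G z y x) (hG.curvature_bianchi hz u v w)
    simp only [map_add, add_apply, map_zero, zero_apply] at this
    simp only [hG.symm z hz w u, hG.symm z hz v u, hG.symm z hz w v]
    linarith
  · simp only [sec u v, hG.symm z hz v u]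
    ring

end IsLocalMetric

end LocalMetric

/-! ### Covariant derivatives of fields, along maps and of second order. -/

section CovariantDerivative

variable {E : Type*} [NormedAddCommGroup E] [NormedSpace ℝ E]
  {E' : Type*} [NormedAddCommGroup E'] [NormedSpace ℝ E']

/-- The covariant derivative, for the connection with Christoffel symbols `Γ`, of a vector field
along a map `F`. -/
noncomputable def covAlong (Γ : E' → E' →L[ℝ] E' →L[ℝ] E') (F W : E → E') (z u : E) : E' :=
  fderiv ℝ W z u + Γ (F z) (fderiv ℝ F z u) (W z)

/-- The covariant differential of a vector field. -/
noncomputable def covDeriv (Γ : E → E →L[ℝ] E →L[ℝ] E) (X : E → E) (z : E) : E →L[ℝ] E :=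
  fderiv ℝ X z + (Γ z).flip (X z)

/-- The second covariant differential of a vector field. -/
noncomputable def covDeriv₂ (Γ : E → E →L[ℝ] E →L[ℝ] E) (X : E → E) (z a b : E) : E :=
  fderiv ℝ (covDeriv Γ X) z a b + Γ z a (covDeriv Γ X z b) - covDeriv Γ X z (Γ z a b)

theorem covDeriv_apply (Γ : E → E →L[ℝ] E →L[ℝ] E) (X : E → E) (z a : E) :
    covDeriv Γ X z a = fderiv ℝ X z a + Γ z a (X z) := by
  simp [covDeriv]

theorem contDiffAt_covDeriv {Γ : E → E →L[ℝ] E →L[ℝ] E} {X : E → E} {z : E}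
    (hΓ : ContDiffAt ℝ ∞ Γ z) (hX : ContDiffAt ℝ ∞ X z) :
    ContDiffAt ℝ ∞ (covDeriv Γ X) z := by
  have h1 : ContDiffAt ℝ ∞ (fun y => (Γ y).flip) z :=
    (ContinuousLinearMap.flipₗᵢ ℝ E E E).toContinuousLinearEquiv.contDiff.contDiffAt.comp z hΓ
  exact (hX.fderiv_right (by simp)).add (h1.clm_apply hX)

theorem contDiffAt_covAlong {Γ : E' → E' →L[ℝ] E' →L[ℝ] E'} {F W : E → E'} {z : E}
    (hΓ : ContDiffAt ℝ ∞ Γ (F z)) (hF : ContDiffAt ℝ ∞ F z) (hW : ContDiffAt ℝ ∞ W z) (u : E) :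
    ContDiffAt ℝ ∞ (fun y => covAlong Γ F W y u) z :=
  ((hW.fderiv_right (by simp)).clm_apply contDiffAt_const).add
    (((hΓ.comp z hF).clm_apply ((hF.fderiv_right (by simp)).clm_apply contDiffAt_const)).clm_apply
      hW)

theorem differentiableAt_fderiv {F : E → E'} {z : E} (hF : ContDiffAt ℝ ∞ F z) :
    DifferentiableAt ℝ (fderiv ℝ F) z :=
  (hF.fderiv_right (m := ∞) (by simp)).differentiableAt (by simp)

/-- The pulled-back connection has the pulled-back curvature, since the second derivatives of F and
W cancel by Schwarz. Applied to N this gives the Codazzi equation, applied to dF(w) the Gauss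
equation. -/
theorem covAlong_comm {Γ : E' → E' →L[ℝ] E' →L[ℝ] E'} {F W : E → E'} {z : E}
    (hΓ : DifferentiableAt ℝ Γ (F z)) (hF : ContDiffAt ℝ ∞ F z) (hW : ContDiffAt ℝ ∞ W z)
    (u v : E) :
    covAlong Γ F (fun y => covAlong Γ F W y v) z u - covAlong Γ F (fun y => covAlong Γ F W y u) z v
      = curvatureOf Γ (F z) (fderiv ℝ F z u) (fderiv ℝ F z v) (W z) := by
  have hF1 := (hF.differentiableAt (by simp)).hasFDerivAt
  have hW1 := (hW.differentiableAt (by simp)).hasFDerivAt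
  have key : ∀ u v, fderiv ℝ (fun y => covAlong Γ F W y v) z u =
      fderiv ℝ (fderiv ℝ W) z u v
      + fderiv ℝ Γ (F z) (fderiv ℝ F z u) (fderiv ℝ F z v) (W z)
      + Γ (F z) (fderiv ℝ (fderiv ℝ F) z u v) (W z)
      + Γ (F z) (fderiv ℝ F z v) (fderiv ℝ W z u) := by
    intro u v
    have h := ((differentiableAt_fderiv hW).hasFDerivAt.clm_apply (hasFDerivAt_const v z)).add
      (((hΓ.hasFDerivAt.comp z hF1).clm_apply ((differentiableAt_fderiv hF).hasFDerivAt.clm_apply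
        (hasFDerivAt_const v z))).clm_apply hW1)
    have h' : fderiv ℝ (fun y => covAlong Γ F W y v) z = _ := h.fderiv
    rw [h']
    simp
    abel
  have sF := hF.isSymmSndFDerivAt minSmoothness_two_le_infty u v
  have sW := hW.isSymmSndFDerivAt minSmoothness_two_le_infty u v
  simp only [covAlong, curvatureOf] at key ⊢
  rw [key u v, key v u, sF, sW]
  simp only [map_add]
  abel

/-- The Ricci identity; symmetry of Γ removes the torsion term. -/
theorem covDeriv₂_comm {Γ : E → E →L[ℝ] E →L[ℝ] E} {X : E → E} {z : E}
    (hΓ : DifferentiableAt ℝ Γ z) (hX : ContDiffAt ℝ ∞ X z) (hs : ∀ u v, Γ z u v = Γ z v u)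
    (a b : E) :
    covDeriv₂ Γ X z a b - covDeriv₂ Γ X z b a = curvatureOf Γ z a b (X z) := by
  have hX1 := (hX.differentiableAt (by simp)).hasFDerivAt
  have key : ∀ a b, fderiv ℝ (covDeriv Γ X) z a b = fderiv ℝ (fderiv ℝ X) z a b
      + fderiv ℝ Γ z a b (X z) + Γ z b (fderiv ℝ X z a) := by
    intro a b
    have hf : HasFDerivAt (fun y => (Γ y).flip) _ z :=
      (ContinuousLinearMap.flipₗᵢ ℝ E E E).toContinuousLinearEquiv.hasFDerivAt.comp z
        hΓ.hasFDerivAt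
    have h := (differentiableAt_fderiv hX).hasFDerivAt.add (hf.clm_apply hX1)
    have h' : fderiv ℝ (covDeriv Γ X) z = _ := h.fderiv
    rw [h']
    simp
    abel
  have sX := hX.isSymmSndFDerivAt minSmoothness_two_le_infty a b
  simp only [covDeriv₂, curvatureOf, key a b, key b a, sX, hs b a]
  simp only [covDeriv_apply, map_add]
  abel

theorem IsLocalMetric.fderiv_along {G : E' → E' →L[ℝ] E' →L[ℝ] ℝ} {U : Set E'}
    [FiniteDimensional ℝ E'] (hG : IsLocalMetric G U) {F A B : E → E'} {z : E} (hz : F z ∈ U)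
    (hF : DifferentiableAt ℝ F z) (hA : DifferentiableAt ℝ A z) (hB : DifferentiableAt ℝ B z)
    (u : E) :
    fderiv ℝ (fun y => G (F y) (A y) (B y)) z u =
      G (F z) (covAlong (christoffel G) F A z u) (B z)
        + G (F z) (A z) (covAlong (christoffel G) F B z u) := by
  have h := (((hG.differentiableAt hz).hasFDerivAt.comp z hF.hasFDerivAt).clm_apply
    hA.hasFDerivAt).clm_apply hB.hasFDerivAt
  have h' : fderiv ℝ (fun y => G (F y) (A y) (B y)) z = _ := h.fderiv
  rw [h']
  simp [covAlong, hG.fderiv_eq hz]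
  ring

end CovariantDerivative

/-- In dimension at least 2 there is b outside the line of a, and p a ≠ 0 would put b on that line.
This is the sole use of the dimension in the Codazzi step and in the equation for dφ. -/
theorem eq_zero_of_smul_symm {V : Type*} [AddCommGroup V] [Module ℝ V]
    (hdim : 2 ≤ Module.finrank ℝ V) (p : V → ℝ) (h : ∀ a b, p a • b = p b • a) (a : V) :
    p a = 0 := by
  obtain ⟨b, hb⟩ : ∃ b, b ∉ Submodule.span ℝ {a} := by
    by_contra! hcon
    have := finrank_span_le_card (R := ℝ) ({a} : Set V)
    rw [Submodule.eq_top_iff'.2 hcon, finrank_top] at this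
    simp at this
    omega
  by_contra hne
  refine hb (Submodule.mem_span_singleton.2 ⟨(p a)⁻¹ * p b, ?_⟩)
  rw [mul_smul, ← h, smul_smul, inv_mul_cancel₀ hne, one_smul]

/-! ### Conformal and concircular fields. -/

section ConformalField

variable {E : Type*} [NormedAddCommGroup E] [NormedSpace ℝ E]

/-- A conformal vector field on an open subset of a vector space with a metric. -/
structure IsLocalConformal (G : E → E →L[ℝ] E →L[ℝ] ℝ) (U : Set E) (X : E → E) (σ : E → ℝ) :
    Prop where
  contDiffAt : ∀ z ∈ U, ContDiffAt ℝ ∞ X z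
  contDiffAt_factor : ∀ z ∈ U, ContDiffAt ℝ ∞ σ z
  conformal : ∀ z ∈ U, ∀ a b, G z (covDeriv (christoffel G) X z a) b
    + G z (covDeriv (christoffel G) X z b) a = 2 * σ z * G z a b

variable [FiniteDimensional ℝ E] {G : E → E →L[ℝ] E →L[ℝ] ℝ} {U : Set E} {X : E → E} {σ : E → ℝ}
  {z : E}

/-- This is the covariant derivative of the conformal equation: G is parallel, so only dσ appears on
the right. The Γ-corrections are instances of the conformal equation itself, with Γ(a, b) or Γ(a, d)
as an argument. -/
theorem IsLocalConformal.fderiv_conformal (hG : IsLocalMetric G U)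
    (hX : IsLocalConformal G U X σ) (hz : z ∈ U) (a b d : E) :
    G z (covDeriv₂ (christoffel G) X z a b) d + G z (covDeriv₂ (christoffel G) X z a d) b
      = 2 * fderiv ℝ σ z a * G z b d := by
  have hdG := (hG.differentiableAt hz).hasFDerivAt
  have hB : HasFDerivAt (covDeriv (christoffel G) X) _ z :=
    ((contDiffAt_covDeriv (hG.contDiffAt_christoffel hz) (hX.contDiffAt z hz)).differentiableAt
      (by simp)).hasFDerivAt
  have hσ := ((hX.contDiffAt_factor z hz).differentiableAt (by simp)).hasFDerivAt
  have hl : ∀ b d, HasFDerivAt (fun y => G y (covDeriv (christoffel G) X y b) d) _ z :=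
    fun b d => (hdG.clm_apply (hB.clm_apply (hasFDerivAt_const b z))).clm_apply
      (hasFDerivAt_const d z)
  have hr := (hσ.const_mul 2).mul
    ((hdG.clm_apply (hasFDerivAt_const b z)).clm_apply (hasFDerivAt_const d z))
  have h := ((hl b d).add (hl d b)).unique (hr.congr_of_eventuallyEq (by
    filter_upwards [hG.eventually_mem hz] with y hy
    simpa using hX.conformal y hy b d))
  have h' := DFunLike.congr_fun h a
  simp [hG.fderiv_eq hz] at h'
  have h1 := hX.conformal z hz (christoffel G z a b) d
  have h2 := hX.conformal z hz (christoffel G z a d) b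
  simp only [covDeriv₂, map_add, map_sub, add_apply, sub_apply]
  rw [hG.symm z hz b] at h'
  linarith

/-- The second covariant differential of a conformal field in a space of constant curvature. -/
theorem IsLocalConformal.covDeriv₂_eq (hG : IsLocalMetric G U)
    (hX : IsLocalConformal G U X σ) (hz : z ∈ U) {c : ℝ}
    (hR : ∀ u v w, curvatureOf (christoffel G) z u v w = c • (G z v w • u - G z u w • v))
    (a b d : E) :
    G z (covDeriv₂ (christoffel G) X z a b) d =
      fderiv ℝ σ z a * G z b d + fderiv ℝ σ z b * G z a d - fderiv ℝ σ z d * G z a b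
        + c * (G z b (X z) * G z a d - G z d (X z) * G z a b) := by
  -- The part of ∇²X antisymmetric in a, b is curvature, and the part symmetric in b, d is given by
  -- dσ. Cycling through a, b, d solves for ∇²X, as in the Koszul formula.
  have hcomm : ∀ a b d, G z (covDeriv₂ (christoffel G) X z a b) d
      - G z (covDeriv₂ (christoffel G) X z b a) d
        = c * (G z b (X z) * G z a d - G z a (X z) * G z b d) := by
    intro a b d
    have h := covDeriv₂_comm (hG.differentiableAt_christoffel hz) (hX.contDiffAt z hz)
      (hG.christoffel_symm hz) a b
    rw [hR] at h
    have h' := congrArg (fun y => G z y d) h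
    simpa using h'
  have h1 := hcomm a b d
  have h2 := hcomm b d a
  have h3 := hcomm d a b
  have h4 := hX.fderiv_conformal hG hz a b d
  have h5 := hX.fderiv_conformal hG hz b d a
  have h6 := hX.fderiv_conformal hG hz d a b
  rw [hG.symm z hz b a, hG.symm z hz d a] at *
  rw [hG.symm z hz d b] at *
  linarith

/-- If `∇Z = φ Id` in a space of constant curvature `k`, then `dφ = -k Z♭`. -/
theorem fderiv_of_covDeriv_eq_smul (hG : IsLocalMetric G U) (hz : z ∈ U)
    (hdim : 2 ≤ Module.finrank ℝ E) {k : ℝ}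
    (hR : ∀ u v w, curvatureOf (christoffel G) z u v w = k • (G z v w • u - G z u w • v))
    {Z : E → E} {φ : E → ℝ} (hZ : ContDiffAt ℝ ∞ Z z) (hφ : DifferentiableAt ℝ φ z)
    (h : ∀ᶠ y in nhds z, ∀ u, covDeriv (christoffel G) Z y u = φ y • u) (a : E) :
    fderiv ℝ φ z a = -k * G z (Z z) a := by
  have h0 := h.self_of_nhds
  -- Since ∇Z = φ Id, the connection terms in ∇²Z cancel.
  have h2 : ∀ a b, covDeriv₂ (christoffel G) Z z a b = fderiv ℝ φ z a • b := by
    intro a b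
    have h3 : fderiv ℝ (covDeriv (christoffel G) Z) z
        = (fderiv ℝ φ z).smulRight (ContinuousLinearMap.id ℝ E) := by
      have : covDeriv (christoffel G) Z =ᶠ[nhds z]
          fun y => φ y • ContinuousLinearMap.id ℝ E := by
        filter_upwards [h] with y hy
        ext u
        simp [hy u]
      rw [this.fderiv_eq, fderiv_fun_smul hφ (differentiableAt_const _)]
      simp
    simp [covDeriv₂, h3, h0]
  have hc : ∀ a b, fderiv ℝ φ z a • b - fderiv ℝ φ z b • a
      = k • (G z b (Z z) • a - G z a (Z z) • b) := by
    intro a b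
    rw [← h2, ← h2, covDeriv₂_comm (hG.differentiableAt_christoffel hz) hZ
      (hG.christoffel_symm hz), hR]
  -- Collecting the Ricci identity by vectors shows that dφ + k Z♭ has the symmetry that forces it
  -- to vanish.
  have h3 := eq_zero_of_smul_symm hdim (fun a => fderiv ℝ φ z a + k * G z a (Z z))
    (fun a b => ?_) a
  · rw [hG.symm z hz]
    linarith
  · have h4 := sub_eq_zero.2 (hc a b)
    rw [← sub_eq_zero, ← h4]
    module

end ConformalField

/-! ### Hypersurface theory in coordinates. -/

section Hypersurface

variable {E : Type*} [NormedAddCommGroup E] [NormedSpace ℝ E]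
  {E' : Type*} [NormedAddCommGroup E'] [NormedSpace ℝ E']

/-- An isometric immersion, with a unit normal field, of open subsets of vector spaces. -/
structure IsLocalHypersurface (G : E → E →L[ℝ] E →L[ℝ] ℝ) (U : Set E)
    (G' : E' → E' →L[ℝ] E' →L[ℝ] ℝ) (U' : Set E') (F N : E → E') (ε : ℝ) : Prop where
  metric : IsLocalMetric G U
  metric' : IsLocalMetric G' U'
  mapsTo : ∀ z ∈ U, F z ∈ U'
  contDiffAt : ∀ z ∈ U, ContDiffAt ℝ ∞ F z
  isometric : ∀ z ∈ U, ∀ u v, G' (F z) (fderiv ℝ F z u) (fderiv ℝ F z v) = G z u v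
  contDiffAt_normal : ∀ z ∈ U, ContDiffAt ℝ ∞ N z
  sign : ε * ε = 1
  unit : ∀ z ∈ U, G' (F z) (N z) (N z) = ε
  normal : ∀ z ∈ U, ∀ u, G' (F z) (N z) (fderiv ℝ F z u) = 0

namespace IsLocalHypersurface

variable {G : E → E →L[ℝ] E →L[ℝ] ℝ} {U : Set E} {G' : E' → E' →L[ℝ] E' →L[ℝ] ℝ} {U' : Set E'}
  {F N : E → E'} {ε : ℝ} {z : E}

theorem differentiableAt (h : IsLocalHypersurface G U G' U' F N ε) (hz : z ∈ U) :
    DifferentiableAt ℝ F z := (h.contDiffAt z hz).differentiableAt (by simp)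

theorem differentiableAt_normal (h : IsLocalHypersurface G U G' U' F N ε) (hz : z ∈ U) :
    DifferentiableAt ℝ N z := (h.contDiffAt_normal z hz).differentiableAt (by simp)

theorem contDiffAt_fderiv (h : IsLocalHypersurface G U G' U' F N ε) (hz : z ∈ U) (v : E) :
    ContDiffAt ℝ ∞ (fun y => fderiv ℝ F y v) z :=
  ((h.contDiffAt z hz).fderiv_right (by simp)).clm_apply contDiffAt_const

theorem differentiableAt_fderiv (h : IsLocalHypersurface G U G' U' F N ε) (hz : z ∈ U) (v : E) :
    DifferentiableAt ℝ (fun y => fderiv ℝ F y v) z :=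
  (h.contDiffAt_fderiv hz v).differentiableAt (by simp)

theorem injective_fderiv (h : IsLocalHypersurface G U G' U' F N ε) (hz : z ∈ U) :
    Function.Injective (fderiv ℝ F z) := by
  intro u v huv
  refine h.metric.eq_of_forall hz fun w => ?_
  rw [← h.isometric z hz, ← h.isometric z hz, huv]

variable [FiniteDimensional ℝ E']

/-- Schwarz for F together with vanishing ambient torsion; this is the source of the symmetry of the
shape form. -/
theorem covAlong_fderiv_symm (h : IsLocalHypersurface G U G' U' F N ε) (hz : z ∈ U) (u v : E) :
    covAlong (christoffel G') F (fun y => fderiv ℝ F y v) z u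
      = covAlong (christoffel G') F (fun y => fderiv ℝ F y u) z v := by
  have key : ∀ u v, fderiv ℝ (fun y => fderiv ℝ F y v) z u = fderiv ℝ (fderiv ℝ F) z u v := by
    intro u v
    have := ((RicciSoliton.differentiableAt_fderiv (h.contDiffAt z hz)).hasFDerivAt.clm_apply
      (hasFDerivAt_const v z)).fderiv
    rw [this]; simp
  simp only [covAlong]
  rw [key, key, (h.contDiffAt z hz).isSymmSndFDerivAt minSmoothness_two_le_infty u v,
    h.metric'.christoffel_symm (h.mapsTo z hz)]

variable [FiniteDimensional ℝ E]

/-- The tangential part of the Gauss formula. -/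
theorem inner_covAlong_fderiv (h : IsLocalHypersurface G U G' U' F N ε) (hz : z ∈ U)
    (u v w : E) :
    G' (F z) (covAlong (christoffel G') F (fun y => fderiv ℝ F y v) z u) (fderiv ℝ F z w)
      = G z (christoffel G z u v) w := by
  -- Differentiating the isometry condition expresses dG through the ambient connection; the
  -- Christoffel combination then isolates a single term.
  have key : ∀ u v w, fderiv ℝ G z u v w =
      G' (F z) (covAlong (christoffel G') F (fun y => fderiv ℝ F y v) z u) (fderiv ℝ F z w)
      + G' (F z) (covAlong (christoffel G') F (fun y => fderiv ℝ F y w) z u) (fderiv ℝ F z v) := by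
    intro u v w
    rw [h.metric'.symm _ (h.mapsTo z hz) _ (fderiv ℝ F z v),
      ← h.metric'.fderiv_along (h.mapsTo z hz) (h.differentiableAt hz)
        (h.differentiableAt_fderiv hz v) (h.differentiableAt_fderiv hz w),
      ← fderiv_clm_apply₂ (h.metric.differentiableAt hz)]
    refine DFunLike.congr_fun (Filter.EventuallyEq.fderiv_eq ?_) u
    filter_upwards [h.metric.eventually_mem hz] with y hy using (h.isometric y hy v w).symm
  rw [h.metric.apply_christoffel hz, key u v w, key v u w, key w u v,
    h.covAlong_fderiv_symm hz v u, h.covAlong_fderiv_symm hz w u, h.covAlong_fderiv_symm hz w v]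
  ring

theorem inner_covAlong_normal (h : IsLocalHypersurface G U G' U' F N ε) (hz : z ∈ U) (u : E) :
    G' (F z) (covAlong (christoffel G') F N z u) (N z) = 0 := by
  have h1 := h.metric'.fderiv_along (h.mapsTo z hz) (h.differentiableAt hz)
    (h.differentiableAt_normal hz) (h.differentiableAt_normal hz) u
  have h2 : fderiv ℝ (fun y => G' (F y) (N y) (N y)) z = fderiv ℝ (fun _ => ε) z :=
    Filter.EventuallyEq.fderiv_eq (by
      filter_upwards [h.metric.eventually_mem hz] with y hy using h.unit y hy)
  rw [h2, h.metric'.symm _ (h.mapsTo z hz) (N z)] at h1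
  simp at h1
  linarith

/-- Differentiate the orthogonality of N and dF(v). This is the normal part of the Gauss formula. -/
theorem inner_normal_covAlong_fderiv (h : IsLocalHypersurface G U G' U' F N ε) (hz : z ∈ U)
    (u v : E) :
    G' (F z) (N z) (covAlong (christoffel G') F (fun y => fderiv ℝ F y v) z u) =
      -G' (F z) (covAlong (christoffel G') F N z u) (fderiv ℝ F z v) := by
  have h1 := h.metric'.fderiv_along (h.mapsTo z hz) (h.differentiableAt hz)
    (h.differentiableAt_normal hz) (h.differentiableAt_fderiv hz v) u
  have h2 : fderiv ℝ (fun y => G' (F y) (N y) (fderiv ℝ F y v)) z = fderiv ℝ (fun _ => (0 : ℝ)) z :=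
    Filter.EventuallyEq.fderiv_eq (by
      filter_upwards [h.metric.eventually_mem hz] with y hy using h.normal y hy v)
  rw [h2] at h1
  simp at h1
  linarith

theorem shape_symm (h : IsLocalHypersurface G U G' U' F N ε) (hz : z ∈ U) (u v : E) :
    G' (F z) (covAlong (christoffel G') F N z u) (fderiv ℝ F z v)
      = G' (F z) (covAlong (christoffel G') F N z v) (fderiv ℝ F z u) := by
  have h1 := h.inner_normal_covAlong_fderiv hz u v
  rw [h.covAlong_fderiv_symm hz, h.inner_normal_covAlong_fderiv hz] at h1
  linarith

/-- The map (w, a) ↦ dF(w) + aN is injective: pairing with N kills a because ε ≠ 0, and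
nondegeneracy of G kills w. Codimension one makes it surjective. -/
theorem exists_decomposition (h : IsLocalHypersurface G U G' U' F N ε) (hz : z ∈ U)
    (hdim : Module.finrank ℝ E' = Module.finrank ℝ E + 1) (y : E') :
    ∃ (w : E) (a : ℝ), y = fderiv ℝ F z w + a • N z := by
  let T : (E × ℝ) →ₗ[ℝ] E' :=
    (fderiv ℝ F z : E →ₗ[ℝ] E').coprod (LinearMap.toSpanSingleton ℝ E' (N z))
  have hT : ∀ p : E × ℝ, T p = fderiv ℝ F z p.1 + p.2 • N z := fun p => by simp [T]
  have hinj : Function.Injective T := by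
    rw [← LinearMap.ker_eq_bot, LinearMap.ker_eq_bot']
    rintro ⟨w, a⟩ hp
    rw [hT] at hp
    have ha : a = 0 := by
      have h1 := congrArg (fun y => G' (F z) (N z) y) hp
      simp [h.normal z hz, h.unit z hz] at h1
      rcases h1 with h1 | h1
      · exact h1
      · have := h.sign
        simp [h1] at this
    have hw : w = 0 := by
      refine h.metric.nondegenerate z hz w fun v => ?_
      rw [← h.isometric z hz]
      simp [ha] at hp
      simp [hp]
    simp [ha, hw]
  have hsurj : Function.Surjective T :=
    (LinearMap.injective_iff_surjective_of_finrank_eq_finrank (by simp [hdim])).1 hinj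
  obtain ⟨⟨w, a⟩, hp⟩ := hsurj y
  exact ⟨w, a, by rw [← hp, hT]⟩

theorem ext_inner (h : IsLocalHypersurface G U G' U' F N ε) (hz : z ∈ U)
    (hdim : Module.finrank ℝ E' = Module.finrank ℝ E + 1) {x y : E'}
    (ht : ∀ w, G' (F z) x (fderiv ℝ F z w) = G' (F z) y (fderiv ℝ F z w))
    (hn : G' (F z) x (N z) = G' (F z) y (N z)) : x = y := by
  refine h.metric'.eq_of_forall (h.mapsTo z hz) fun w => ?_
  obtain ⟨w, a, rfl⟩ := h.exists_decomposition hz hdim w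
  simp [ht, hn]

theorem exists_covAlong_normal_eq (h : IsLocalHypersurface G U G' U' F N ε) (hz : z ∈ U)
    (hdim : Module.finrank ℝ E' = Module.finrank ℝ E + 1) (u : E) :
    ∃ w, covAlong (christoffel G') F N z u = fderiv ℝ F z w := by
  obtain ⟨w, a, hw⟩ := h.exists_decomposition hz hdim (covAlong (christoffel G') F N z u)
  have h1 := h.inner_covAlong_normal hz u
  rw [hw, h.metric'.symm _ (h.mapsTo z hz)] at h1
  simp [h.normal z hz, h.unit z hz] at h1
  rcases h1 with h1 | h1
  · exact ⟨w, by simp [hw, h1]⟩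
  · have := h.sign
    simp [h1] at this

/-- The derivative of the metric along the tangent part `V` of a conformal field. -/
theorem covDeriv_tangentPart (h : IsLocalHypersurface G U G' U' F N ε) (hz : z ∈ U)
    {X : E' → E'} {σ : E' → ℝ} (hX : IsLocalConformal G' U' X σ) {V : E → E} {C : E → ℝ}
    (hV : DifferentiableAt ℝ V z) (hC : DifferentiableAt ℝ C z)
    (hdec : ∀ᶠ y in nhds z, X (F y) = fderiv ℝ F y (V y) + (ε * C y) • N y) (u v : E) :
    G z (covDeriv (christoffel G) V z u) v + G z u (covDeriv (christoffel G) V z v) =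
      2 * σ (F z) * G z u v
        - 2 * ε * C z * G' (F z) (covAlong (christoffel G') F N z u) (fderiv ℝ F z v) := by
  have hFz := h.mapsTo z hz
  have hdF := (RicciSoliton.differentiableAt_fderiv (h.contDiffAt z hz)).hasFDerivAt
  have hXd := ((hX.contDiffAt _ hFz).differentiableAt (by simp)).hasFDerivAt
  -- Differentiate X ∘ F = dF(V) + εC N and take the tangential part: the dC term is normal and
  -- drops out. Symmetrizing in u, v and using the conformal equation concludes.
  have h1 : ∀ u v, G' (F z) (covDeriv (christoffel G') X (F z) (fderiv ℝ F z u)) (fderiv ℝ F z v)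
      = G z (covDeriv (christoffel G) V z u) v
        + ε * C z * G' (F z) (covAlong (christoffel G') F N z u) (fderiv ℝ F z v) := by
    intro u v
    have hl := hXd.comp z (h.differentiableAt hz).hasFDerivAt
    have hr := (hdF.clm_apply hV.hasFDerivAt).add
      ((hC.hasFDerivAt.const_mul ε).smul (h.differentiableAt_normal hz).hasFDerivAt)
    have heq := DFunLike.congr_fun (hl.unique (hr.congr_of_eventuallyEq hdec)) u
    have hdec0 := hdec.self_of_nhds
    have hc : fderiv ℝ (fun y => fderiv ℝ F y (V z)) z u = fderiv ℝ (fderiv ℝ F) z u (V z) := by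
      rw [(hdF.clm_apply (hasFDerivAt_const (V z) z)).fderiv]; simp
    have heq2 : covDeriv (christoffel G') X (F z) (fderiv ℝ F z u)
        = covAlong (christoffel G') F (fun y => fderiv ℝ F y (V z)) z u
          + fderiv ℝ F z (fderiv ℝ V z u) + (ε * C z) • covAlong (christoffel G') F N z u
          + (ε * fderiv ℝ C z u) • N z := by
      rw [covDeriv_apply]
      simp at heq
      simp only [covAlong]
      rw [heq, hc, hdec0]
      simp only [map_add, map_smul]
      module
    rw [heq2]
    simp [h.inner_covAlong_fderiv hz, h.isometric z hz, h.normal z hz, covDeriv_apply]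
    ring
  have h2 := hX.conformal _ hFz (fderiv ℝ F z u) (fderiv ℝ F z v)
  rw [h1, h1, h.isometric z hz, h.shape_symm hz v u] at h2
  rw [h.metric.symm z hz u]
  linarith

section Umbilic

variable {α : E → ℝ}

/-- The Gauss formula of an umbilic hypersurface. -/
theorem covAlong_fderiv_of_umbilic (h : IsLocalHypersurface G U G' U' F N ε) (hz : z ∈ U)
    (hdim : Module.finrank ℝ E' = Module.finrank ℝ E + 1) {a : ℝ}
    (hα : ∀ u, covAlong (christoffel G') F N z u = -(a • fderiv ℝ F z u)) (u v : E) :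
    covAlong (christoffel G') F (fun y => fderiv ℝ F y v) z u
      = fderiv ℝ F z (christoffel G z u v) + (ε * a * G z u v) • N z := by
  have hFz := h.mapsTo z hz
  refine h.ext_inner hz hdim (fun w => ?_) ?_
  · simp [h.inner_covAlong_fderiv hz, h.isometric z hz, h.normal z hz]
  · rw [h.metric'.symm _ hFz, h.inner_normal_covAlong_fderiv hz, hα,
      h.metric'.symm _ hFz _ (N z)]
    have := h.sign
    simp [h.isometric z hz, h.normal z hz, h.unit z hz]
    linear_combination (- a * G z u v) * this

/-- The Codazzi equation: the factor of an umbilic hypersurface of a space of constant curvature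
is locally constant. -/
theorem fderiv_umbilic_factor (h : IsLocalHypersurface G U G' U' F N ε) (hz : z ∈ U)
    (hdim2 : 2 ≤ Module.finrank ℝ E) {c : ℝ}
    (hR : ∀ u v w, curvatureOf (christoffel G') (F z) u v w
      = c • (G' (F z) v w • u - G' (F z) u w • v))
    (hα : ∀ᶠ y in nhds z, ∀ u, covAlong (christoffel G') F N y u = -(α y • fderiv ℝ F y u))
    (hαd : DifferentiableAt ℝ α z) (u : E) : fderiv ℝ α z u = 0 := by
  have hFz := h.mapsTo z hz
  -- Differentiate ∇'_v N = -α dF(v). In the commutator the second derivatives of F cancel, leaving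
  -- dα(v) dF(u) - dα(u) dF(v), while R'(dF u, dF v)N = 0 because N is normal.
  have key : ∀ u v, covAlong (christoffel G') F (fun y => covAlong (christoffel G') F N y v) z u
      = -(α z • covAlong (christoffel G') F (fun y => fderiv ℝ F y v) z u
        + fderiv ℝ α z u • fderiv ℝ F z v) := by
    intro u v
    have he : (fun y => covAlong (christoffel G') F N y v)
        =ᶠ[nhds z] fun y => -(α y • fderiv ℝ F y v) := by
      filter_upwards [hα] with y hy using hy v
    have hd := (hαd.hasFDerivAt.smul (h.differentiableAt_fderiv hz v).hasFDerivAt).neg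
    have hd' : fderiv ℝ (fun y => -(α y • fderiv ℝ F y v)) z = _ := hd.fderiv
    rw [covAlong, he.fderiv_eq, hα.self_of_nhds, hd']
    simp [covAlong]
    abel
  have h1 := fun u v => covAlong_comm (h.metric'.differentiableAt_christoffel hFz)
    (h.contDiffAt z hz) (h.contDiffAt_normal z hz) u v
  refine eq_zero_of_smul_symm hdim2 (fun u => fderiv ℝ α z u) (fun u v => ?_) u
  refine h.injective_fderiv hz ?_
  have h2 := h1 u v
  rw [key, key, hR, h.covAlong_fderiv_symm hz v u, h.metric'.symm _ hFz _ (N z),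
    h.metric'.symm _ hFz _ (N z)] at h2
  simp only [h.normal z hz, zero_smul, sub_self, smul_zero] at h2
  rw [map_smul, map_smul, ← sub_eq_zero, ← neg_eq_zero, ← h2]
  abel

/-- The Gauss equation of an umbilic hypersurface of a space of constant curvature. -/
theorem curvature_of_umbilic (h : IsLocalHypersurface G U G' U' F N ε) (hz : z ∈ U)
    (hdim : Module.finrank ℝ E' = Module.finrank ℝ E + 1) {c a : ℝ}
    (hR : ∀ u v w, curvatureOf (christoffel G') (F z) u v w
      = c • (G' (F z) v w • u - G' (F z) u w • v))
    (hα : ∀ᶠ y in nhds z, ∀ u, covAlong (christoffel G') F N y u = -(a • fderiv ℝ F y u))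
    (u v w : E) :
    curvatureOf (christoffel G) z u v w = (c + ε * a ^ 2) • (G z v w • u - G z u w • v) := by
  have hFz := h.mapsTo z hz
  have hdF := (RicciSoliton.differentiableAt_fderiv (h.contDiffAt z hz)).hasFDerivAt
  have hdΓ := (h.metric.differentiableAt_christoffel hz).hasFDerivAt
  have hα0 := hα.self_of_nhds
  have hgauss : ∀ᶠ y in nhds z, ∀ u v,
      covAlong (christoffel G') F (fun y => fderiv ℝ F y v) y u
        = fderiv ℝ F y (christoffel G y u v) + (ε * a * G y u v) • N y := by
    filter_upwards [h.metric.eventually_mem hz, hα] with y hy hαy u v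
    exact h.covAlong_fderiv_of_umbilic hy hdim hαy u v
  -- Only the tangential part matters, as the normal coefficient b vanishes on pairing with dF(x).
  -- The term -εa² G(v, w) u comes from differentiating N in the Gauss formula.
  have key : ∀ u v, ∃ b : ℝ, covAlong (christoffel G') F
      (fun y => covAlong (christoffel G') F (fun y => fderiv ℝ F y w) y v) z u
      = fderiv ℝ F z (fderiv ℝ (christoffel G) z u v w + christoffel G z u (christoffel G z v w)
        - (ε * a ^ 2 * G z v w) • u) + b • N z := by
    intro u v
    have he : (fun y => covAlong (christoffel G') F (fun y => fderiv ℝ F y w) y v)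
        =ᶠ[nhds z] fun y => fderiv ℝ F y (christoffel G y v w) + (ε * a * G y v w) • N y := by
      filter_upwards [hgauss] with y hy using hy v w
    have hd := (hdF.clm_apply ((hdΓ.clm_apply (hasFDerivAt_const v z)).clm_apply
      (hasFDerivAt_const w z))).add
      (((((h.metric.differentiableAt hz).hasFDerivAt.clm_apply (hasFDerivAt_const v z)).clm_apply
      (hasFDerivAt_const w z)).const_mul (ε * a)).smul (h.differentiableAt_normal hz).hasFDerivAt)
    have hd' : fderiv ℝ (fun y => fderiv ℝ F y (christoffel G y v w) + (ε * a * G y v w) • N y) z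
      = _ := hd.fderiv
    have hc : ∀ x, fderiv ℝ (fun y => fderiv ℝ F y x) z u = fderiv ℝ (fderiv ℝ F) z u x := by
      intro x
      rw [(hdF.clm_apply (hasFDerivAt_const x z)).fderiv]; simp
    have h1 := hgauss.self_of_nhds u (christoffel G z v w)
    have h2 := hα0 u
    simp only [covAlong, hc] at h1 h2
    refine ⟨ε * a * G z u (christoffel G z v w) + ε * a * fderiv ℝ G z u v w, ?_⟩
    rw [covAlong, he.fderiv_eq, hgauss.self_of_nhds, hd']
    simp
    rw [eq_sub_of_add_eq h1, eq_sub_of_add_eq h2]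
    module
  obtain ⟨b₁, h1⟩ := key u v
  obtain ⟨b₂, h2⟩ := key v u
  have h3 := covAlong_comm (h.metric'.differentiableAt_christoffel hFz)
    (h.contDiffAt z hz) (h.contDiffAt_fderiv hz w) u v
  rw [h1, h2, hR, h.isometric z hz, h.isometric z hz] at h3
  refine h.metric.eq_of_forall hz fun x => ?_
  have h4 := congrArg (fun y => G' (F z) y (fderiv ℝ F z x)) h3
  simp only [map_add, map_sub, map_smul, add_apply, sub_apply, smul_apply, h.isometric z hz,
    h.normal z hz, smul_eq_mul] at h4
  simp only [curvatureOf, map_add, map_sub, map_smul, add_apply, sub_apply, smul_apply, smul_eq_mul]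
  linarith

/-- The Hessian of the angle function of a conformal field along an umbilic hypersurface of
constant factor in a space of constant curvature. -/
theorem hessian_angle (h : IsLocalHypersurface G U G' U' F N ε) (hz : z ∈ U)
    (hdim : Module.finrank ℝ E' = Module.finrank ℝ E + 1) {c a : ℝ}
    (hR : ∀ u v w, curvatureOf (christoffel G') (F z) u v w
      = c • (G' (F z) v w • u - G' (F z) u w • v))
    (hα : ∀ᶠ y in nhds z, ∀ u, covAlong (christoffel G') F N y u = -(a • fderiv ℝ F y u))
    {X : E' → E'} {σ : E' → ℝ} (hX : IsLocalConformal G' U' X σ) (u v : E) :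
    fderiv ℝ (fun y => fderiv ℝ (fun y => G' (F y) (X (F y)) (N y)) y v) z u
      - fderiv ℝ (fun y => G' (F y) (X (F y)) (N y)) z (christoffel G z u v)
      = -(fderiv ℝ σ (F z) (N z) + a * σ (F z)
          + (c + ε * a ^ 2) * G' (F z) (X (F z)) (N z)) * G z u v := by
  have hFz := h.mapsTo z hz
  have hXF : ∀ y ∈ U, DifferentiableAt ℝ (fun y => X (F y)) y := fun y hy =>
    ((hX.contDiffAt _ (h.mapsTo y hy)).differentiableAt (by simp)).comp y (h.differentiableAt hy)
  have hcovX : ∀ y ∈ U, ∀ u, covAlong (christoffel G') F (fun y => X (F y)) y u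
      = covDeriv (christoffel G') X (F y) (fderiv ℝ F y u) := by
    intro y hy u
    have hd : fderiv ℝ (fun y => X (F y)) y = _ :=
      (((hX.contDiffAt _ (h.mapsTo y hy)).differentiableAt (by simp)).hasFDerivAt.comp y
      (h.differentiableAt hy).hasFDerivAt).fderiv
    rw [covAlong, hd, covDeriv_apply]
    simp
  -- The first derivative of C is needed on a neighbourhood, since it is differentiated again.
  have hC : ∀ᶠ y in nhds z, ∀ v, fderiv ℝ (fun y => G' (F y) (X (F y)) (N y)) y v =
      G' (F y) (covDeriv (christoffel G') X (F y) (fderiv ℝ F y v)) (N y)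
        - a * G' (F y) (X (F y)) (fderiv ℝ F y v) := by
    filter_upwards [h.metric.eventually_mem hz, hα] with y hy hαy v
    rw [h.metric'.fderiv_along (h.mapsTo y hy) (h.differentiableAt hy) (hXF y hy)
      (h.differentiableAt_normal hy), hαy, hcovX y hy]
    simp
    ring
  have hB : DifferentiableAt ℝ (covDeriv (christoffel G') X) (F z) :=
    (contDiffAt_covDeriv (h.metric'.contDiffAt_christoffel hFz)
      (hX.contDiffAt _ hFz)).differentiableAt (by simp)
  have hBF := hB.hasFDerivAt.comp z (h.differentiableAt hz).hasFDerivAt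
  have hBv := hBF.clm_apply (h.differentiableAt_fderiv hz v).hasFDerivAt
  have hBd : DifferentiableAt ℝ
      (fun y => covDeriv (christoffel G') X (F y) (fderiv ℝ F y v)) z := hBv.differentiableAt
  have hcovB : covAlong (christoffel G') F
      (fun y => covDeriv (christoffel G') X (F y) (fderiv ℝ F y v)) z u
      = covDeriv₂ (christoffel G') X (F z) (fderiv ℝ F z u) (fderiv ℝ F z v)
        + covDeriv (christoffel G') X (F z)
          (covAlong (christoffel G') F (fun y => fderiv ℝ F y v) z u) := by
    have hd : fderiv ℝ (fun y => covDeriv (christoffel G') X (F y) (fderiv ℝ F y v)) z = _ :=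
      hBv.fderiv
    rw [covAlong, hd, covDeriv₂, covAlong]
    simp
    abel
  have hd1 : DifferentiableAt ℝ (fun y => G' (F y)
      (covDeriv (christoffel G') X (F y) (fderiv ℝ F y v)) (N y)) z :=
    ((((h.metric'.differentiableAt hFz).comp z (h.differentiableAt hz)).clm_apply hBd).clm_apply
      (h.differentiableAt_normal hz))
  have hd2 : DifferentiableAt ℝ (fun y => G' (F y) (X (F y)) (fderiv ℝ F y v)) z :=
    ((((h.metric'.differentiableAt hFz).comp z (h.differentiableAt hz)).clm_apply
      (hXF z hz)).clm_apply (h.differentiableAt_fderiv hz v))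
  have hCv : (fun y => fderiv ℝ (fun y => G' (F y) (X (F y)) (N y)) y v) =ᶠ[nhds z]
      fun y => G' (F y) (covDeriv (christoffel G') X (F y) (fderiv ℝ F y v)) (N y)
        - a * G' (F y) (X (F y)) (fderiv ℝ F y v) := by
    filter_upwards [hC] with y hy using hy v
  rw [hCv.fderiv_eq, fderiv_fun_sub hd1 (hd2.const_mul a), fderiv_const_mul hd2,
    hC.self_of_nhds, sub_apply, smul_apply,
    h.metric'.fderiv_along hFz (h.differentiableAt hz) hBd (h.differentiableAt_normal hz),
    h.metric'.fderiv_along hFz (h.differentiableAt hz) (hXF z hz)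
      (h.differentiableAt_fderiv hz v), hcovB, hcovX z hz,
    h.covAlong_fderiv_of_umbilic hz hdim hα.self_of_nhds, hα.self_of_nhds]
  have h1 := hX.covDeriv₂_eq h.metric' hFz hR (fderiv ℝ F z u) (fderiv ℝ F z v) (N z)
  have h2 := hX.conformal _ hFz (fderiv ℝ F z u) (fderiv ℝ F z v)
  have h3 := hX.conformal _ hFz (N z) (N z)
  have hN : ∀ u, G' (F z) (fderiv ℝ F z u) (N z) = 0 := fun u => by
    rw [h.metric'.symm _ hFz, h.normal z hz]
  rw [hN, hN, h.isometric z hz, h.metric'.symm _ hFz (N z)] at h1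
  rw [h.isometric z hz] at h2
  rw [h.unit z hz] at h3
  simp only [map_add, map_smul, map_neg, add_apply, smul_apply, smul_eq_mul, h1]
  have h4 := h.sign
  -- The normal part of ∇'_u dF(v) contributes this term, which by ε² = 1 amounts to +aσ G(u, v).
  -- The two cross terms add up to -2aσ G(u, v) by the conformal equation, leaving -aσ G(u, v).
  have h5 : G' (F z) (covDeriv (christoffel G') X (F z) (N z)) (N z) = σ (F z) * ε := by
    linarith
  rw [h5]
  linear_combination (-a) * h2 + a * σ (F z) * G z u v * h4

end Umbilic

end IsLocalHypersurface

end Hypersurface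

/-! ### Tangent vectors, functions and vector fields in a chart. -/

section Chart

variable {E : Type*} [NormedAddCommGroup E] [NormedSpace ℝ E]
  {M : Type*} [TopologicalSpace M] [ChartedSpace E M] [IsManifold 𝓘(ℝ, E) ∞ M]

/-- The coordinates of tangent vectors at `y` in the chart at `x`. -/
noncomputable def toChart (x y : M) : TangentSpace 𝓘(ℝ, E) y →L[ℝ] E :=
  (trivializationAt E (TangentSpace 𝓘(ℝ, E)) x).continuousLinearMapAt ℝ y

/-- The tangent vector at `y` with given coordinates in the chart at `x`. -/
noncomputable def ofChart (x y : M) : E →L[ℝ] TangentSpace 𝓘(ℝ, E) y :=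
  (trivializationAt E (TangentSpace 𝓘(ℝ, E)) x).symmL ℝ y

/-- The coordinate expression of a vector field in the chart at `x`. -/
noncomputable def chartField (x : M) (X : (y : M) → TangentSpace 𝓘(ℝ, E) y) (z : E) : E :=
  toChart x ((extChartAt 𝓘(ℝ, E) x).symm z) (X ((extChartAt 𝓘(ℝ, E) x).symm z))

/-- The coordinate expression of a field of bilinear forms in the chart at `x`. -/
noncomputable def chartMetric (g : BilinField 𝓘(ℝ, E) M) (x : M) (z : E) : E →L[ℝ] E →L[ℝ] ℝ :=
  (ContinuousLinearMap.precomp ℝ (ofChart x ((extChartAt 𝓘(ℝ, E) x).symm z))) ∘L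
    g ((extChartAt 𝓘(ℝ, E) x).symm z) ∘L ofChart x ((extChartAt 𝓘(ℝ, E) x).symm z)

/-- Smoothness at a point of a vector field. -/
def IsSmoothFieldAt (X : (y : M) → TangentSpace 𝓘(ℝ, E) y) (y : M) : Prop :=
  ContMDiffAt 𝓘(ℝ, E) 𝓘(ℝ, E).tangent ∞ (fun y => (⟨y, X y⟩ : TangentBundle 𝓘(ℝ, E) M)) y

variable {x y : M} {z : E}

theorem mem_baseSet (hy : y ∈ (extChartAt 𝓘(ℝ, E) x).source) :
    y ∈ (trivializationAt E (TangentSpace 𝓘(ℝ, E)) x).baseSet := by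
  simpa using hy

theorem toChart_ofChart (hy : y ∈ (extChartAt 𝓘(ℝ, E) x).source) (v : E) :
    toChart x y (ofChart x y v) = v :=
  Trivialization.continuousLinearMapAt_symmL _ (mem_baseSet hy) v

theorem ofChart_toChart (hy : y ∈ (extChartAt 𝓘(ℝ, E) x).source) (v : TangentSpace 𝓘(ℝ, E) y) :
    ofChart x y (toChart x y v) = v :=
  Trivialization.symmL_continuousLinearMapAt _ (mem_baseSet hy) v

theorem toChart_injective (hy : y ∈ (extChartAt 𝓘(ℝ, E) x).source) :
    Function.Injective (toChart x y : TangentSpace 𝓘(ℝ, E) y → E) :=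
  Function.LeftInverse.injective (ofChart_toChart hy)

theorem trivializationAt_snd (hy : y ∈ (extChartAt 𝓘(ℝ, E) x).source)
    (v : TangentSpace 𝓘(ℝ, E) y) :
    (trivializationAt E (TangentSpace 𝓘(ℝ, E)) x (⟨y, v⟩ : TangentBundle 𝓘(ℝ, E) M)).2
      = toChart x y v := by
  rw [toChart, Trivialization.continuousLinearMapAt_apply,
    Trivialization.coe_linearMapAt_of_mem _ (mem_baseSet hy)]

theorem trivializationAt_symm (hy : y ∈ (extChartAt 𝓘(ℝ, E) x).source) (v : E) :
    (trivializationAt E (TangentSpace 𝓘(ℝ, E)) x).symm y v = ofChart x y v := by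
  rw [ofChart, Trivialization.symmL_apply _ (mem_baseSet hy)]

theorem locExt_apply (hy : y ∈ (extChartAt 𝓘(ℝ, E) x).source) (u : TangentSpace 𝓘(ℝ, E) x) :
    locExt u y = ofChart x y (toChart x x u) := by
  rw [← trivializationAt_symm hy, ← trivializationAt_snd (mem_extChartAt_source x)]
  rfl

theorem locExt_self (u : TangentSpace 𝓘(ℝ, E) x) : locExt u x = u := by
  rw [locExt_apply (mem_extChartAt_source x), ofChart_toChart (mem_extChartAt_source x)]

theorem isOpen_source (x : M) : IsOpen (extChartAt 𝓘(ℝ, E) x).source :=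
  isOpen_extChartAt_source x

theorem isOpen_target (x : M) : IsOpen (extChartAt 𝓘(ℝ, E) x).target :=
  isOpen_extChartAt_target x

theorem contMDiffAt_symm (hz : z ∈ (extChartAt 𝓘(ℝ, E) x).target) :
    ContMDiffAt 𝓘(ℝ, E) 𝓘(ℝ, E) ∞ (extChartAt 𝓘(ℝ, E) x).symm z :=
  (contMDiffOn_extChartAt_symm x z hz).contMDiffAt ((isOpen_target x).mem_nhds hz)

theorem contMDiffAt_chart (hy : y ∈ (extChartAt 𝓘(ℝ, E) x).source) :
    ContMDiffAt 𝓘(ℝ, E) 𝓘(ℝ, E) ∞ (extChartAt 𝓘(ℝ, E) x) y :=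
  contMDiffAt_extChartAt' (by simpa using hy)

theorem mfderiv_symm (hz : z ∈ (extChartAt 𝓘(ℝ, E) x).target) :
    mfderiv 𝓘(ℝ, E) 𝓘(ℝ, E) (extChartAt 𝓘(ℝ, E) x).symm z
      = ofChart (E := E) x ((extChartAt 𝓘(ℝ, E) x).symm z) := by
  have hy := (extChartAt 𝓘(ℝ, E) x).map_target hz
  rw [ofChart, TangentBundle.symmL_trivializationAt (by simpa using hy),
    (extChartAt 𝓘(ℝ, E) x).right_inv hz]
  simp
  rfl

theorem mfderiv_chart (hy : y ∈ (extChartAt 𝓘(ℝ, E) x).source) :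
    mfderiv 𝓘(ℝ, E) 𝓘(ℝ, E) (extChartAt 𝓘(ℝ, E) x) y = toChart x y := by
  rw [toChart, TangentBundle.continuousLinearMapAt_trivializationAt (by simpa using hy)]

theorem contDiffAt_comp_symm {F : Type*} [NormedAddCommGroup F] [NormedSpace ℝ F] {h : M → F}
    (hy : y ∈ (extChartAt 𝓘(ℝ, E) x).source) (hh : ContMDiffAt 𝓘(ℝ, E) 𝓘(ℝ, F) ∞ h y) :
    ContDiffAt ℝ ∞ (fun z => h ((extChartAt 𝓘(ℝ, E) x).symm z)) (extChartAt 𝓘(ℝ, E) x y) := by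
  have hz := (extChartAt 𝓘(ℝ, E) x).map_source hy
  rw [← (extChartAt 𝓘(ℝ, E) x).left_inv hy] at hh
  exact (hh.comp _ (contMDiffAt_symm hz)).contDiffAt

theorem contMDiffAt_of_comp_symm {F : Type*} [NormedAddCommGroup F] [NormedSpace ℝ F] {h : M → F}
    (hy : y ∈ (extChartAt 𝓘(ℝ, E) x).source)
    (hh : ContDiffAt ℝ ∞ (fun z => h ((extChartAt 𝓘(ℝ, E) x).symm z)) (extChartAt 𝓘(ℝ, E) x y)) :
    ContMDiffAt 𝓘(ℝ, E) 𝓘(ℝ, F) ∞ h y := by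
  refine (hh.contMDiffAt.comp y (contMDiffAt_chart hy)).congr_of_eventuallyEq ?_
  filter_upwards [(isOpen_source x).mem_nhds hy] with y' hy'
  simp only [Function.comp_apply, (extChartAt 𝓘(ℝ, E) x).left_inv hy']

/-- The differential of a function in a chart. -/
theorem mvfderiv_eq {F : Type*} [NormedAddCommGroup F] [NormedSpace ℝ F] {h : M → F}
    (hy : y ∈ (extChartAt 𝓘(ℝ, E) x).source) (hh : MDifferentiableAt 𝓘(ℝ, E) 𝓘(ℝ, F) h y)
    (u : TangentSpace 𝓘(ℝ, E) y) :
    mvfderiv 𝓘(ℝ, E) h y u = fderiv ℝ (fun z => h ((extChartAt 𝓘(ℝ, E) x).symm z))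
      (extChartAt 𝓘(ℝ, E) x y) (toChart x y u) := by
  have hz := (extChartAt 𝓘(ℝ, E) x).map_source hy
  have hl := (extChartAt 𝓘(ℝ, E) x).left_inv hy
  have hc := mfderiv_comp_apply_of_eq (I := 𝓘(ℝ, E)) (extChartAt 𝓘(ℝ, E) x y) hh
    ((contMDiffAt_symm hz).mdifferentiableAt (by simp)) hl (toChart (E := E) x y u)
  rw [mfderiv_eq_fderiv] at hc
  have : (fun z => h ((extChartAt 𝓘(ℝ, E) x).symm z)) = h ∘ (extChartAt 𝓘(ℝ, E) x).symm := rfl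
  rw [this]
  refine Eq.trans ?_ hc.symm
  rw [mfderiv_symm hz]
  -- The point y and its image under the chart and back are only propositionally equal, so the base
  -- point is generalized before the tangent spaces over the two are identified.
  have key : ∀ y', y' = y → ∀ w : E, w = toChart x y u →
      mvfderiv 𝓘(ℝ, E) h y u = mfderiv 𝓘(ℝ, E) 𝓘(ℝ, F) h y (ofChart x y' w) := by
    rintro _ rfl w rfl
    rw [ofChart_toChart hy]
    rfl
  exact key _ hl _ rfl

theorem isSmoothFieldAt_iff {X : (y : M) → TangentSpace 𝓘(ℝ, E) y}
    (hy : y ∈ (extChartAt 𝓘(ℝ, E) x).source) :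
    IsSmoothFieldAt X y ↔ ContDiffAt ℝ ∞ (chartField x X) (extChartAt 𝓘(ℝ, E) x y) := by
  have h1 := Trivialization.contMDiffAt_section_iff (IB := 𝓘(ℝ, E)) (n := ∞) (s := X)
    (trivializationAt E (TangentSpace 𝓘(ℝ, E)) x) (mem_baseSet hy)
  have h2 : (fun y => (trivializationAt E (TangentSpace 𝓘(ℝ, E)) x
      (⟨y, X y⟩ : TangentBundle 𝓘(ℝ, E) M)).2) =ᶠ[nhds y] fun y => toChart x y (X y) := by
    filter_upwards [(isOpen_source x).mem_nhds hy] with y' hy' using trivializationAt_snd hy' _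
  refine h1.trans ?_
  rw [h2.contMDiffAt_iff]
  exact ⟨fun h => contDiffAt_comp_symm hy h, fun h => contMDiffAt_of_comp_symm hy h⟩

theorem isSmoothFieldAt_ofChart (hy : y ∈ (extChartAt 𝓘(ℝ, E) x).source) (v : E) :
    IsSmoothFieldAt (fun y => ofChart x y v) y := by
  rw [isSmoothFieldAt_iff hy]
  refine (contDiffAt_const (c := v)).congr_of_eventuallyEq ?_
  filter_upwards [(isOpen_target x).mem_nhds ((extChartAt 𝓘(ℝ, E) x).map_source hy)] with z hz
  exact toChart_ofChart ((extChartAt 𝓘(ℝ, E) x).map_target hz) v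

theorem isSmoothFieldAt_congr {X Y : (y : M) → TangentSpace 𝓘(ℝ, E) y}
    (h : ∀ᶠ y' in nhds y, X y' = Y y') (hY : IsSmoothFieldAt Y y) : IsSmoothFieldAt X y := by
  refine ContMDiffAt.congr_of_eventuallyEq hY ?_
  filter_upwards [h] with y' hy'
  rw [hy']

theorem isSmoothFieldAt_locExt (hy : y ∈ (extChartAt 𝓘(ℝ, E) x).source)
    (u : TangentSpace 𝓘(ℝ, E) x) : IsSmoothFieldAt (locExt u) y := by
  refine isSmoothFieldAt_congr ?_ (isSmoothFieldAt_ofChart hy (toChart x x u))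
  filter_upwards [(isOpen_source x).mem_nhds hy] with y' hy' using locExt_apply hy' u

theorem chartField_locExt (hz : z ∈ (extChartAt 𝓘(ℝ, E) x).target)
    (u : TangentSpace 𝓘(ℝ, E) x) : chartField x (locExt u) z = toChart x x u := by
  have hy := (extChartAt 𝓘(ℝ, E) x).map_target hz
  rw [chartField, locExt_apply hy, toChart_ofChart hy]

theorem chartField_apply (hy : y ∈ (extChartAt 𝓘(ℝ, E) x).source)
    (X : (y : M) → TangentSpace 𝓘(ℝ, E) y) :
    chartField x X (extChartAt 𝓘(ℝ, E) x y) = toChart x y (X y) := by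
  rw [chartField, (extChartAt 𝓘(ℝ, E) x).left_inv hy]

variable [CompleteSpace E]

/-- The Lie bracket in a chart. -/
theorem toChart_mlieBracket {X Y : (y : M) → TangentSpace 𝓘(ℝ, E) y}
    (hy : y ∈ (extChartAt 𝓘(ℝ, E) x).source) (hX : IsSmoothFieldAt X y)
    (hY : IsSmoothFieldAt Y y) :
    toChart x y (VectorField.mlieBracket 𝓘(ℝ, E) X Y y) =
      fderiv ℝ (chartField x Y) (extChartAt 𝓘(ℝ, E) x y) (toChart x y (X y))
        - fderiv ℝ (chartField x X) (extChartAt 𝓘(ℝ, E) x y) (toChart x y (Y y)) := by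
  have hz := (extChartAt 𝓘(ℝ, E) x).map_source hy
  have hl := (extChartAt 𝓘(ℝ, E) x).left_inv hy
  -- The coordinate expression of a field is its pullback under the inverse chart, so naturality of
  -- the Lie bracket reduces the claim to the bracket in E.
  have hpull : ∀ W : (y : M) → TangentSpace 𝓘(ℝ, E) y, ∀ z ∈ (extChartAt 𝓘(ℝ, E) x).target,
      VectorField.mpullback 𝓘(ℝ, E) 𝓘(ℝ, E) (extChartAt 𝓘(ℝ, E) x).symm W z
        = chartField x W z := by
    intro W z hz
    have hy' := (extChartAt 𝓘(ℝ, E) x).map_target hz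
    refine DFunLike.congr_fun (ContinuousLinearMap.inverse_eq
      (g := toChart (E := E) x ((extChartAt 𝓘(ℝ, E) x).symm z)) ?_ ?_) _
    · rw [mfderiv_symm hz]
      ext v
      exact ofChart_toChart hy' v
    · rw [mfderiv_symm hz]
      ext v
      exact toChart_ofChart hy' v
  have hXd : MDifferentiableAt 𝓘(ℝ, E) 𝓘(ℝ, E).tangent
      (fun y => (⟨y, X y⟩ : TangentBundle 𝓘(ℝ, E) M)) y := hX.mdifferentiableAt (by simp)
  have hYd : MDifferentiableAt 𝓘(ℝ, E) 𝓘(ℝ, E).tangent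
      (fun y => (⟨y, Y y⟩ : TangentBundle 𝓘(ℝ, E) M)) y := hY.mdifferentiableAt (by simp)
  have : IsManifold 𝓘(ℝ, E) (minSmoothness ℝ 2) M := .of_le minSmoothness_two_le_infty
  have hm := VectorField.mpullback_mlieBracket (I := 𝓘(ℝ, E)) (I' := 𝓘(ℝ, E))
    (x₀ := extChartAt 𝓘(ℝ, E) x y) (V := X) (W := Y) (f := (extChartAt 𝓘(ℝ, E) x).symm)
    (by rw [hl]; exact hXd) (by rw [hl]; exact hYd) (contMDiffAt_symm hz)
    minSmoothness_two_le_infty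
  rw [hpull _ _ hz, chartField_apply hy] at hm
  rw [hm]
  have hev : ∀ W : (y : M) → TangentSpace 𝓘(ℝ, E) y,
      VectorField.mpullback 𝓘(ℝ, E) 𝓘(ℝ, E) (extChartAt 𝓘(ℝ, E) x).symm W
        =ᶠ[nhds (extChartAt 𝓘(ℝ, E) x y)] chartField x W := by
    intro W
    filter_upwards [(isOpen_target x).mem_nhds hz] with z hz using hpull W z hz
  rw [← chartField_apply hy X, ← chartField_apply hy Y]
  refine (Filter.EventuallyEq.mlieBracket_vectorField_eq (hev X) (hev Y)).trans ?_
  refine (congrFun (VectorField.mlieBracketWithin_eq_lieBracketWithin (V := chartField x X)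
    (W := chartField x Y) (s := Set.univ)) _).trans ?_
  have h := congrFun (VectorField.lieBracketWithin_univ (𝕜 := ℝ) (V := chartField x X)
    (W := chartField x Y)) (extChartAt 𝓘(ℝ, E) x y)
  exact h

end Chart

/-! ### Connection, curvature, Lie derivative and Hessian of a metric in a chart. -/

section MetricField

variable {E : Type*} [NormedAddCommGroup E] [NormedSpace ℝ E]
  {M : Type*} [TopologicalSpace M] [ChartedSpace E M] [IsManifold 𝓘(ℝ, E) ∞ M]

/-- A smooth field of nondegenerate symmetric bilinear forms. -/
structure IsMetricField (g : BilinField 𝓘(ℝ, E) M) : Prop where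
  symm : ∀ (y : M) (u v : TangentSpace 𝓘(ℝ, E) y), g y u v = g y v u
  nondegenerate : ∀ (y : M) (u : TangentSpace 𝓘(ℝ, E) y), (∀ v, g y u v = 0) → u = 0
  smooth : ∀ (X Y : (y : M) → TangentSpace 𝓘(ℝ, E) y) (y : M), IsSmoothFieldAt X y →
    IsSmoothFieldAt Y y → ContMDiffAt 𝓘(ℝ, E) 𝓘(ℝ, ℝ) ∞ (fun y => g y (X y) (Y y)) y

variable {g : BilinField 𝓘(ℝ, E) M} {x y : M} {z : E}

theorem chartMetric_apply (u v : E) :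
    chartMetric g x z u v = g ((extChartAt 𝓘(ℝ, E) x).symm z)
      (ofChart x ((extChartAt 𝓘(ℝ, E) x).symm z) u)
      (ofChart x ((extChartAt 𝓘(ℝ, E) x).symm z) v) := rfl

theorem chartMetric_toChart (hy : y ∈ (extChartAt 𝓘(ℝ, E) x).source)
    (u v : TangentSpace 𝓘(ℝ, E) y) :
    chartMetric g x (extChartAt 𝓘(ℝ, E) x y) (toChart x y u) (toChart x y v) = g y u v := by
  have key : ∀ y', y' = y → ∀ a b : E, a = toChart x y u → b = toChart x y v →
      g y' (ofChart x y' a) (ofChart x y' b) = g y u v := by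
    rintro _ rfl _ _ rfl rfl
    rw [ofChart_toChart hy, ofChart_toChart hy]
  exact key _ ((extChartAt 𝓘(ℝ, E) x).left_inv hy) _ _ rfl rfl

theorem chartMetric_chartField (hz : z ∈ (extChartAt 𝓘(ℝ, E) x).target)
    (X Y : (y : M) → TangentSpace 𝓘(ℝ, E) y) :
    chartMetric g x z (chartField x X z) (chartField x Y z) =
      g ((extChartAt 𝓘(ℝ, E) x).symm z) (X ((extChartAt 𝓘(ℝ, E) x).symm z))
        (Y ((extChartAt 𝓘(ℝ, E) x).symm z)) := by
  have hy := (extChartAt 𝓘(ℝ, E) x).map_target hz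
  rw [chartMetric_apply, chartField, chartField, ofChart_toChart hy, ofChart_toChart hy]

namespace IsMetricField

/-- The choice in `sharp` is meaningful once some dual vector exists, and nondegeneracy makes that
vector unique. -/
theorem sharp_eq (hg : IsMetricField g) {φ : TangentSpace 𝓘(ℝ, E) y → ℝ}
    {w : TangentSpace 𝓘(ℝ, E) y} (h : ∀ v, g y w v = φ v) : sharp g y φ = w := by
  have hs : ∀ v, g y (sharp g y φ) v = φ v :=
    Classical.epsilon_spec (p := fun w => ∀ v, g y w v = φ v) ⟨w, h⟩
  rw [← sub_eq_zero]
  refine hg.nondegenerate y _ fun v => ?_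
  rw [map_sub, sub_apply, hs, h, sub_self]

variable [FiniteDimensional ℝ E]

theorem isLocalMetric (hg : IsMetricField g) (x : M) :
    IsLocalMetric (chartMetric g x) (extChartAt 𝓘(ℝ, E) x).target where
  isOpen := isOpen_target x
  contDiffOn := by
    refine contDiffOn_clm_apply.2 fun u => contDiffOn_clm_apply.2 fun v z hz => ?_
    have hy := (extChartAt 𝓘(ℝ, E) x).map_target hz
    have h := contDiffAt_comp_symm hy (hg.smooth _ _ _ (isSmoothFieldAt_ofChart hy u)
      (isSmoothFieldAt_ofChart hy v))
    rw [(extChartAt 𝓘(ℝ, E) x).right_inv hz] at h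
    exact h.contDiffWithinAt
  symm z _ u v := by rw [chartMetric_apply, hg.symm, chartMetric_apply]
  nondegenerate z hz u hu := by
    have hy := (extChartAt 𝓘(ℝ, E) x).map_target hz
    have h0 : ofChart x ((extChartAt 𝓘(ℝ, E) x).symm z) u = 0 := by
      refine hg.nondegenerate _ _ fun v => ?_
      have h := hu (toChart x ((extChartAt 𝓘(ℝ, E) x).symm z) v)
      rwa [chartMetric_apply, ofChart_toChart hy] at h
    rw [← toChart_ofChart hy u, h0, map_zero]

/-- The derivative of a scalar product of vector fields in a chart. -/
theorem mvfderiv_inner (hg : IsMetricField g) (hy : y ∈ (extChartAt 𝓘(ℝ, E) x).source)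
    {Y Z : (y : M) → TangentSpace 𝓘(ℝ, E) y} (hY : IsSmoothFieldAt Y y)
    (hZ : IsSmoothFieldAt Z y) (u : TangentSpace 𝓘(ℝ, E) y) :
    mvfderiv 𝓘(ℝ, E) (fun y => g y (Y y) (Z y)) y u =
      fderiv ℝ (chartMetric g x) (extChartAt 𝓘(ℝ, E) x y) (toChart x y u) (toChart x y (Y y))
        (toChart x y (Z y))
      + chartMetric g x (extChartAt 𝓘(ℝ, E) x y)
        (fderiv ℝ (chartField x Y) (extChartAt 𝓘(ℝ, E) x y) (toChart x y u)) (toChart x y (Z y))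
      + chartMetric g x (extChartAt 𝓘(ℝ, E) x y) (toChart x y (Y y))
        (fderiv ℝ (chartField x Z) (extChartAt 𝓘(ℝ, E) x y) (toChart x y u)) := by
  have hz := (extChartAt 𝓘(ℝ, E) x).map_source hy
  rw [mvfderiv_eq hy ((hg.smooth Y Z y hY hZ).mdifferentiableAt (by simp))]
  have he : (fun z => g ((extChartAt 𝓘(ℝ, E) x).symm z) (Y ((extChartAt 𝓘(ℝ, E) x).symm z))
      (Z ((extChartAt 𝓘(ℝ, E) x).symm z))) =ᶠ[nhds (extChartAt 𝓘(ℝ, E) x y)]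
      fun z => chartMetric g x z (chartField x Y z) (chartField x Z z) := by
    filter_upwards [(isOpen_target x).mem_nhds hz] with z hz
    rw [chartMetric_chartField hz]
  have hY' := (((isSmoothFieldAt_iff hy).1 hY).differentiableAt (by simp)).hasFDerivAt
  have hZ' := (((isSmoothFieldAt_iff hy).1 hZ).differentiableAt (by simp)).hasFDerivAt
  have hd : fderiv ℝ (fun z => chartMetric g x z (chartField x Y z) (chartField x Z z))
      (extChartAt 𝓘(ℝ, E) x y) = _ :=
    ((((hg.isLocalMetric x).differentiableAt hz).hasFDerivAt.clm_apply hY').clm_apply hZ').fderiv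
  rw [he.fderiv_eq, hd]
  simp [chartField_apply hy, -extChartAt]
  ring

/-- The Koszul formula in a chart. -/
theorem koszul_eq (hg : IsMetricField g) (hy : y ∈ (extChartAt 𝓘(ℝ, E) x).source)
    {X Y Z : (y : M) → TangentSpace 𝓘(ℝ, E) y} (hX : IsSmoothFieldAt X y)
    (hY : IsSmoothFieldAt Y y) (hZ : IsSmoothFieldAt Z y) :
    koszul g X Y Z y = chartMetric g x (extChartAt 𝓘(ℝ, E) x y)
      (covDeriv (christoffel (chartMetric g x)) (chartField x Y) (extChartAt 𝓘(ℝ, E) x y)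
        (toChart x y (X y))) (toChart x y (Z y)) := by
  have hz := (extChartAt 𝓘(ℝ, E) x).map_source hy
  have hG := hg.isLocalMetric x
  rw [koszul, hg.mvfderiv_inner hy hY hZ, hg.mvfderiv_inner hy hX hZ, hg.mvfderiv_inner hy hX hY,
    ← chartMetric_toChart hy, ← chartMetric_toChart hy, ← chartMetric_toChart hy,
    toChart_mlieBracket hy hX hY, toChart_mlieBracket hy hX hZ, toChart_mlieBracket hy hY hZ,
    covDeriv_apply, map_add, add_apply, chartField_apply hy, hG.apply_christoffel hz]
  simp only [map_sub, sub_apply]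
  have h1 := hG.symm _ hz (fderiv ℝ (chartField x Z) (extChartAt 𝓘(ℝ, E) x y) (toChart x y (X y)))
    (toChart x y (Y y))
  have h2 := hG.symm _ hz (fderiv ℝ (chartField x Z) (extChartAt 𝓘(ℝ, E) x y) (toChart x y (Y y)))
    (toChart x y (X y))
  have h3 := hG.symm _ hz (fderiv ℝ (chartField x Y) (extChartAt 𝓘(ℝ, E) x y) (toChart x y (Z y)))
    (toChart x y (X y))
  rw [h1, h2, h3]
  ring

/-- The Levi-Civita connection in a chart. -/
theorem toChart_leviCivita (hg : IsMetricField g) (hy : y ∈ (extChartAt 𝓘(ℝ, E) x).source)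
    {X Y : (y : M) → TangentSpace 𝓘(ℝ, E) y} (hX : IsSmoothFieldAt X y)
    (hY : IsSmoothFieldAt Y y) :
    toChart x y (leviCivita g X Y y) =
      covDeriv (christoffel (chartMetric g x)) (chartField x Y) (extChartAt 𝓘(ℝ, E) x y)
        (toChart x y (X y)) := by
  have h : leviCivita g X Y y = ofChart x y
      (covDeriv (christoffel (chartMetric g x)) (chartField x Y) (extChartAt 𝓘(ℝ, E) x y)
        (toChart x y (X y))) := by
    refine hg.sharp_eq fun v => ?_
    rw [hg.koszul_eq hy hX hY (isSmoothFieldAt_locExt (mem_extChartAt_source y) v), locExt_self,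
      ← chartMetric_toChart hy, toChart_ofChart hy]
  rw [h, toChart_ofChart hy]

/-- The curvature at the centre of a chart. -/
theorem toChart_curvature (hg : IsMetricField g) (x : M) (u v w : TangentSpace 𝓘(ℝ, E) x) :
    toChart x x (curvature g x u v w) =
      curvatureOf (christoffel (chartMetric g x)) (extChartAt 𝓘(ℝ, E) x x) (toChart x x u)
        (toChart x x v) (toChart x x w) := by
  have hx := mem_extChartAt_source (I := 𝓘(ℝ, E)) x
  have hG := hg.isLocalMetric x
  have hz := (extChartAt 𝓘(ℝ, E) x).map_source hx
  have hnear := hG.eventually_mem hz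
  have hΓ := hG.contDiffAt_christoffel hz
  -- The extensions are constant in the chart at x, so their covariant derivative is Γ(v, w) on a
  -- whole neighbourhood and may be differentiated again.
  have hcov : ∀ v w : TangentSpace 𝓘(ℝ, E) x,
      chartField x (leviCivita g (locExt v) (locExt w)) =ᶠ[nhds (extChartAt 𝓘(ℝ, E) x x)]
        fun z => christoffel (chartMetric g x) z (toChart x x v) (toChart x x w) := by
    intro v w
    filter_upwards [hnear] with z hz
    have hy := (extChartAt 𝓘(ℝ, E) x).map_target hz
    have hev : chartField x (locExt w) =ᶠ[nhds z] fun _ => toChart x x w := by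
      filter_upwards [(isOpen_target x).mem_nhds hz] with z hz using chartField_locExt hz w
    rw [chartField, hg.toChart_leviCivita hy (isSmoothFieldAt_locExt hy v)
      (isSmoothFieldAt_locExt hy w), (extChartAt 𝓘(ℝ, E) x).right_inv hz, covDeriv_apply,
      hev.fderiv_eq, hev.self_of_nhds, locExt_apply hy, toChart_ofChart hy]
    simp
  have hsmooth : ∀ v w : TangentSpace 𝓘(ℝ, E) x,
      IsSmoothFieldAt (leviCivita g (locExt v) (locExt w)) x := by
    intro v w
    rw [isSmoothFieldAt_iff hx]
    exact ((hΓ.clm_apply contDiffAt_const).clm_apply contDiffAt_const).congr_of_eventuallyEq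
      (hcov v w)
  have hcov₂ : ∀ u v w : TangentSpace 𝓘(ℝ, E) x,
      toChart x x (leviCivita g (locExt u) (leviCivita g (locExt v) (locExt w)) x) =
        fderiv ℝ (christoffel (chartMetric g x)) (extChartAt 𝓘(ℝ, E) x x) (toChart x x u)
          (toChart x x v) (toChart x x w)
        + christoffel (chartMetric g x) (extChartAt 𝓘(ℝ, E) x x) (toChart x x u)
          (christoffel (chartMetric g x) (extChartAt 𝓘(ℝ, E) x x) (toChart x x v)
            (toChart x x w)) := by
    intro u v w
    rw [hg.toChart_leviCivita hx (isSmoothFieldAt_locExt hx u) (hsmooth v w), covDeriv_apply,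
      (hcov v w).fderiv_eq, (hcov v w).self_of_nhds,
      fderiv_clm_apply₂ (hG.differentiableAt_christoffel hz), locExt_self]
  -- Constant fields commute, so the bracket term of the curvature vanishes.
  have hbr : chartField x (VectorField.mlieBracket 𝓘(ℝ, E) (locExt u) (locExt v))
      =ᶠ[nhds (extChartAt 𝓘(ℝ, E) x x)] fun _ => 0 := by
    filter_upwards [hnear] with z hz
    have hy := (extChartAt 𝓘(ℝ, E) x).map_target hz
    have hev : ∀ w : TangentSpace 𝓘(ℝ, E) x,
        chartField x (locExt w) =ᶠ[nhds z] fun _ => toChart x x w := by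
      intro w
      filter_upwards [(isOpen_target x).mem_nhds hz] with z hz using chartField_locExt hz w
    rw [chartField, toChart_mlieBracket hy (isSmoothFieldAt_locExt hy u)
      (isSmoothFieldAt_locExt hy v), (extChartAt 𝓘(ℝ, E) x).right_inv hz, (hev u).fderiv_eq,
      (hev v).fderiv_eq]
    simp
  have hbr0 : toChart x x (VectorField.mlieBracket 𝓘(ℝ, E) (locExt u) (locExt v) x) = 0 := by
    rw [← chartField_apply hx]
    exact hbr.self_of_nhds
  have hbrs : IsSmoothFieldAt (VectorField.mlieBracket 𝓘(ℝ, E) (locExt u) (locExt v)) x := by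
    rw [isSmoothFieldAt_iff hx]
    exact contDiffAt_const.congr_of_eventuallyEq hbr
  rw [curvature, map_sub, map_sub, hcov₂, hcov₂,
    hg.toChart_leviCivita hx hbrs (isSmoothFieldAt_locExt hx w), hbr0, map_zero, curvatureOf]
  abel

/-- The Lie derivative of the metric in a chart. -/
theorem lieDerivMetric_eq (hg : IsMetricField g) (hy : y ∈ (extChartAt 𝓘(ℝ, E) x).source)
    {X : (y : M) → TangentSpace 𝓘(ℝ, E) y} (hX : IsSmoothFieldAt X y)
    (u v : TangentSpace 𝓘(ℝ, E) y) :
    lieDerivMetric g X y u v =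
      chartMetric g x (extChartAt 𝓘(ℝ, E) x y)
        (covDeriv (christoffel (chartMetric g x)) (chartField x X) (extChartAt 𝓘(ℝ, E) x y)
          (toChart x y u)) (toChart x y v)
      + chartMetric g x (extChartAt 𝓘(ℝ, E) x y)
        (covDeriv (christoffel (chartMetric g x)) (chartField x X) (extChartAt 𝓘(ℝ, E) x y)
          (toChart x y v)) (toChart x y u) := by
  have hz := (extChartAt 𝓘(ℝ, E) x).map_source hy
  have hG := hg.isLocalMetric x
  have hs := fun u : TangentSpace 𝓘(ℝ, E) y =>
    isSmoothFieldAt_locExt (mem_extChartAt_source (I := 𝓘(ℝ, E)) y) u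
  rw [lieDerivMetric, hg.mvfderiv_inner hy (hs u) (hs v), ← chartMetric_toChart hy,
    ← chartMetric_toChart hy, toChart_mlieBracket hy hX (hs u), toChart_mlieBracket hy hX (hs v),
    locExt_self, locExt_self, covDeriv_apply, covDeriv_apply, chartField_apply hy,
    hG.fderiv_eq hz, hG.christoffel_symm hz (toChart x y u),
    hG.christoffel_symm hz (toChart x y v)]
  simp only [map_sub, sub_apply, map_add, add_apply]
  rw [hG.symm _ hz (fderiv ℝ (chartField x X) _ (toChart x y v)),
    hG.symm _ hz (christoffel (chartMetric g x) _ _ (toChart x y v))]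
  ring

variable {h : M → ℝ}

theorem chartField_grad (hg : IsMetricField g) (hz : z ∈ (extChartAt 𝓘(ℝ, E) x).target)
    (hh : MDifferentiableAt 𝓘(ℝ, E) 𝓘(ℝ, ℝ) h ((extChartAt 𝓘(ℝ, E) x).symm z)) :
    chartField x (grad g h) z =
      (chartMetric g x z).inverse (fderiv ℝ (fun z => h ((extChartAt 𝓘(ℝ, E) x).symm z)) z) := by
  have hy := (extChartAt 𝓘(ℝ, E) x).map_target hz
  have hr := (extChartAt 𝓘(ℝ, E) x).right_inv hz
  rw [chartField, grad]
  set w := (chartMetric g x z).inverse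
    (fderiv ℝ (fun z => h ((extChartAt 𝓘(ℝ, E) x).symm z)) z) with hw
  have hs : sharp g ((extChartAt 𝓘(ℝ, E) x).symm z)
      (fun v => mvfderiv 𝓘(ℝ, E) h ((extChartAt 𝓘(ℝ, E) x).symm z) v)
      = ofChart x ((extChartAt 𝓘(ℝ, E) x).symm z) w := by
    refine hg.sharp_eq fun v => ?_
    rw [mvfderiv_eq hy hh, hr, ← (hg.isLocalMetric x).apply_inverse hz
      (fderiv ℝ (fun z => h ((extChartAt 𝓘(ℝ, E) x).symm z)) z), ← hw, chartMetric_apply,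
      ofChart_toChart hy]
  rw [hs, toChart_ofChart hy]

theorem contDiffAt_chartField_grad (hg : IsMetricField g)
    (hz : z ∈ (extChartAt 𝓘(ℝ, E) x).target) (hh : ContMDiff 𝓘(ℝ, E) 𝓘(ℝ, ℝ) ∞ h) :
    ContDiffAt ℝ ∞ (chartField x (grad g h)) z := by
  have hy := (extChartAt 𝓘(ℝ, E) x).map_target hz
  have h1 := contDiffAt_comp_symm hy (hh _)
  rw [(extChartAt 𝓘(ℝ, E) x).right_inv hz] at h1
  refine (((hg.isLocalMetric x).contDiffAt_inverse hz).clm_apply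
    (h1.fderiv_right (by simp))).congr_of_eventuallyEq ?_
  filter_upwards [(isOpen_target x).mem_nhds hz] with z' hz'
  exact hg.chartField_grad hz' (hh.mdifferentiable (by simp) _)

/-- The Hessian in a chart. -/
theorem hess_eq (hg : IsMetricField g) (hy : y ∈ (extChartAt 𝓘(ℝ, E) x).source)
    (hh : ContMDiff 𝓘(ℝ, E) 𝓘(ℝ, ℝ) ∞ h) (u v : TangentSpace 𝓘(ℝ, E) y) :
    hess g h y u v =
      chartMetric g x (extChartAt 𝓘(ℝ, E) x y)
        (covDeriv (christoffel (chartMetric g x)) (chartField x (grad g h))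
          (extChartAt 𝓘(ℝ, E) x y) (toChart x y u)) (toChart x y v) := by
  have hz := (extChartAt 𝓘(ℝ, E) x).map_source hy
  rw [hess, ← chartMetric_toChart hy, hg.toChart_leviCivita hy
    (isSmoothFieldAt_locExt (mem_extChartAt_source (I := 𝓘(ℝ, E)) y) u)
    ((isSmoothFieldAt_iff hy).2 (hg.contDiffAt_chartField_grad hz hh)), locExt_self]

/-- The Hessian in a chart, in terms of the derivatives of the function. -/
theorem hess_eq_fderiv (hg : IsMetricField g) (hy : y ∈ (extChartAt 𝓘(ℝ, E) x).source)
    (hh : ContMDiff 𝓘(ℝ, E) 𝓘(ℝ, ℝ) ∞ h) (u v : TangentSpace 𝓘(ℝ, E) y) :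
    hess g h y u v =
      fderiv ℝ (fun z => fderiv ℝ (fun z => h ((extChartAt 𝓘(ℝ, E) x).symm z)) z (toChart x y v))
          (extChartAt 𝓘(ℝ, E) x y) (toChart x y u)
        - fderiv ℝ (fun z => h ((extChartAt 𝓘(ℝ, E) x).symm z)) (extChartAt 𝓘(ℝ, E) x y)
          (christoffel (chartMetric g x) (extChartAt 𝓘(ℝ, E) x y) (toChart x y u)
            (toChart x y v)) := by
  have hz := (extChartAt 𝓘(ℝ, E) x).map_source hy
  have hG := hg.isLocalMetric x
  have hgrad : ∀ z ∈ (extChartAt 𝓘(ℝ, E) x).target, ∀ w,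
      fderiv ℝ (fun z => h ((extChartAt 𝓘(ℝ, E) x).symm z)) z w
        = chartMetric g x z (chartField x (grad g h) z) w := by
    intro z hz w
    rw [hg.chartField_grad hz (hh.mdifferentiable (by simp) _), hG.apply_inverse hz]
  have he : (fun z => fderiv ℝ (fun z => h ((extChartAt 𝓘(ℝ, E) x).symm z)) z (toChart x y v))
      =ᶠ[nhds (extChartAt 𝓘(ℝ, E) x y)]
        fun z => chartMetric g x z (chartField x (grad g h) z) (toChart x y v) := by
    filter_upwards [hG.eventually_mem hz] with z hz using hgrad z hz _
  have hZ := (hg.contDiffAt_chartField_grad hz hh).differentiableAt (by simp)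
  have hd : fderiv ℝ (fun z => chartMetric g x z (chartField x (grad g h) z) (toChart x y v))
      (extChartAt 𝓘(ℝ, E) x y) = _ :=
    (((hG.differentiableAt hz).hasFDerivAt.clm_apply hZ.hasFDerivAt).clm_apply
      (hasFDerivAt_const _ _)).fderiv
  rw [hg.hess_eq hy hh, he.fderiv_eq, hd, hgrad _ hz, covDeriv_apply]
  simp only [add_apply, ContinuousLinearMap.flip_apply, ContinuousLinearMap.comp_apply, zero_apply,
    map_zero, map_add, hG.fderiv_eq hz]
  ring

end IsMetricField

end MetricField

/-! ### Maps and vector fields along maps in charts. -/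

section ChartMap

variable {E : Type*} [NormedAddCommGroup E] [NormedSpace ℝ E]
  {M : Type*} [TopologicalSpace M] [ChartedSpace E M] [IsManifold 𝓘(ℝ, E) ∞ M]
  {E' : Type*} [NormedAddCommGroup E'] [NormedSpace ℝ E']
  {M' : Type*} [TopologicalSpace M'] [ChartedSpace E' M'] [IsManifold 𝓘(ℝ, E') ∞ M']

/-- The expression of a map in the charts at `x` and at its image. -/
noncomputable def chartMap (f : M → M') (x : M) (z : E) : E' :=
  extChartAt 𝓘(ℝ, E') (f x) (f ((extChartAt 𝓘(ℝ, E) x).symm z))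

/-- The expression of a vector field along a map in the charts at `x` and at its image. -/
noncomputable def chartAlong (f : M → M') (x : M) (W : (y : M) → TangentSpace 𝓘(ℝ, E') (f y))
    (z : E) : E' :=
  toChart (f x) (f ((extChartAt 𝓘(ℝ, E) x).symm z)) (W ((extChartAt 𝓘(ℝ, E) x).symm z))

/-- The domain on which `chartMap f x` represents `f`. -/
def chartDomain (f : M → M') (x : M) : Set E :=
  (extChartAt 𝓘(ℝ, E) x).target ∩
    (extChartAt 𝓘(ℝ, E) x).symm ⁻¹' (f ⁻¹' (extChartAt 𝓘(ℝ, E') (f x)).source)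

variable {f : M → M'} {x y : M} {z : E}

theorem isOpen_chartDomain (hf : ContMDiff 𝓘(ℝ, E) 𝓘(ℝ, E') ∞ f) (x : M) :
    IsOpen (chartDomain (E := E) (E' := E') f x) :=
  (continuousOn_extChartAt_symm x).isOpen_inter_preimage (isOpen_target x)
    ((isOpen_source (f x)).preimage hf.continuous)

theorem mem_chartDomain (hy : y ∈ (extChartAt 𝓘(ℝ, E) x).source)
    (hfy : f y ∈ (extChartAt 𝓘(ℝ, E') (f x)).source) :
    extChartAt 𝓘(ℝ, E) x y ∈ chartDomain (E' := E') f x := by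
  refine ⟨(extChartAt 𝓘(ℝ, E) x).map_source hy, ?_⟩
  rw [Set.mem_preimage, (extChartAt 𝓘(ℝ, E) x).left_inv hy]
  exact hfy

theorem mem_chartDomain_self (f : M → M') (x : M) :
    extChartAt 𝓘(ℝ, E) x x ∈ chartDomain (E' := E') f x :=
  mem_chartDomain (mem_extChartAt_source x) (mem_extChartAt_source (f x))

theorem chartMap_mem (hz : z ∈ chartDomain (E' := E') f x) :
    chartMap f x z ∈ (extChartAt 𝓘(ℝ, E') (f x)).target :=
  (extChartAt 𝓘(ℝ, E') (f x)).map_source hz.2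

theorem symm_chartMap (hz : z ∈ chartDomain (E' := E') f x) :
    (extChartAt 𝓘(ℝ, E') (f x)).symm (chartMap f x z) = f ((extChartAt 𝓘(ℝ, E) x).symm z) :=
  (extChartAt 𝓘(ℝ, E') (f x)).left_inv hz.2

theorem chartMap_apply (hy : y ∈ (extChartAt 𝓘(ℝ, E) x).source) :
    chartMap f x (extChartAt 𝓘(ℝ, E) x y) = extChartAt 𝓘(ℝ, E') (f x) (f y) := by
  rw [chartMap, (extChartAt 𝓘(ℝ, E) x).left_inv hy]

theorem chartAlong_apply (hy : y ∈ (extChartAt 𝓘(ℝ, E) x).source)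
    (W : (y : M) → TangentSpace 𝓘(ℝ, E') (f y)) :
    chartAlong f x W (extChartAt 𝓘(ℝ, E) x y) = toChart (f x) (f y) (W y) := by
  rw [chartAlong, (extChartAt 𝓘(ℝ, E) x).left_inv hy]

theorem contDiffAt_chartMap (hf : ContMDiff 𝓘(ℝ, E) 𝓘(ℝ, E') ∞ f)
    (hz : z ∈ chartDomain (E' := E') f x) : ContDiffAt ℝ ∞ (chartMap (E' := E') f x) z := by
  have h := (hf _).comp z (contMDiffAt_symm hz.1)
  exact ((contMDiffAt_chart hz.2).comp z h).contDiffAt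

theorem fderiv_chartMap_apply (hf : ContMDiff 𝓘(ℝ, E) 𝓘(ℝ, E') ∞ f)
    (hz : z ∈ chartDomain (E' := E') f x) (a : E) :
    fderiv ℝ (chartMap f x) z a = toChart (f x) (f ((extChartAt 𝓘(ℝ, E) x).symm z))
      (mfderiv 𝓘(ℝ, E) 𝓘(ℝ, E') f ((extChartAt 𝓘(ℝ, E) x).symm z)
        (ofChart x ((extChartAt 𝓘(ℝ, E) x).symm z) a)) := by
  have h1 := (contMDiffAt_symm hz.1).mdifferentiableAt (by simp)
  have h2 := hf.mdifferentiable (by simp) ((extChartAt 𝓘(ℝ, E) x).symm z)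
  have h3 := (contMDiffAt_chart hz.2).mdifferentiableAt (by simp)
  have hc1 := mfderiv_comp z h2 h1
  have hc2 := mfderiv_comp z (f := f ∘ (extChartAt 𝓘(ℝ, E) x).symm) h3 (h2.comp z h1)
  rw [← mfderiv_eq_fderiv]
  have hc3 := DFunLike.congr_fun hc2 a
  refine hc3.trans ?_
  rw [hc1, mfderiv_symm hz.1]
  exact DFunLike.congr_fun (mfderiv_chart hz.2) _

theorem fderiv_chartMap_toChart (hf : ContMDiff 𝓘(ℝ, E) 𝓘(ℝ, E') ∞ f)
    (hy : y ∈ (extChartAt 𝓘(ℝ, E) x).source)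
    (hfy : f y ∈ (extChartAt 𝓘(ℝ, E') (f x)).source) (u : TangentSpace 𝓘(ℝ, E) y) :
    fderiv ℝ (chartMap f x) (extChartAt 𝓘(ℝ, E) x y) (toChart x y u) =
      toChart (f x) (f y) (mfderiv 𝓘(ℝ, E) 𝓘(ℝ, E') f y u) := by
  rw [fderiv_chartMap_apply hf (mem_chartDomain hy hfy)]
  have key : ∀ y', y' = y → ∀ a : E, a = toChart x y u →
      toChart (f x) (f y') (mfderiv 𝓘(ℝ, E) 𝓘(ℝ, E') f y' (ofChart x y' a)) =
        toChart (f x) (f y) (mfderiv 𝓘(ℝ, E) 𝓘(ℝ, E') f y u) := by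
    rintro _ rfl _ rfl
    rw [ofChart_toChart hy]
  exact key _ ((extChartAt 𝓘(ℝ, E) x).left_inv hy) _ rfl

theorem contMDiffAt_toChart {W : (y : M) → TangentSpace 𝓘(ℝ, E') (f y)} {p : M'}
    (hW : ContMDiffAt 𝓘(ℝ, E) 𝓘(ℝ, E').tangent ∞
      (fun y => (⟨f y, W y⟩ : TangentBundle 𝓘(ℝ, E') M')) y)
    (hf : ContinuousAt f y) (hfy : f y ∈ (extChartAt 𝓘(ℝ, E') p).source) :
    ContMDiffAt 𝓘(ℝ, E) 𝓘(ℝ, E') ∞ (fun y => toChart p (f y) (W y)) y := by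
  have h := ((Trivialization.contMDiffAt_iff (IB := 𝓘(ℝ, E'))
    (e := trivializationAt E' (TangentSpace 𝓘(ℝ, E')) p)
    (by rw [Trivialization.mem_source]; exact mem_baseSet hfy)).1 hW).2
  refine h.congr_of_eventuallyEq ?_
  filter_upwards [hf.preimage_mem_nhds ((isOpen_source p).mem_nhds hfy)] with y' hy'
  exact (trivializationAt_snd hy' _).symm

theorem contDiffAt_chartAlong {W : (y : M) → TangentSpace 𝓘(ℝ, E') (f y)}
    (hf : ContMDiff 𝓘(ℝ, E) 𝓘(ℝ, E') ∞ f)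
    (hW : ContMDiff 𝓘(ℝ, E) 𝓘(ℝ, E').tangent ∞
      (fun y => (⟨f y, W y⟩ : TangentBundle 𝓘(ℝ, E') M')))
    (hz : z ∈ chartDomain (E' := E') f x) : ContDiffAt ℝ ∞ (chartAlong f x W) z := by
  have hy := (extChartAt 𝓘(ℝ, E) x).map_target hz.1
  have h := contDiffAt_comp_symm hy
    (contMDiffAt_toChart (p := f x) (hW _) hf.continuous.continuousAt hz.2)
  rwa [(extChartAt 𝓘(ℝ, E) x).right_inv hz.1] at h

variable {g : BilinField 𝓘(ℝ, E) M} {g' : BilinField 𝓘(ℝ, E') M'}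

theorem chartMetric_chartMap (hz : z ∈ chartDomain (E' := E') f x)
    (u v : TangentSpace 𝓘(ℝ, E') (f ((extChartAt 𝓘(ℝ, E) x).symm z))) :
    chartMetric g' (f x) (chartMap f x z) (toChart (f x) (f ((extChartAt 𝓘(ℝ, E) x).symm z)) u)
      (toChart (f x) (f ((extChartAt 𝓘(ℝ, E) x).symm z)) v)
      = g' (f ((extChartAt 𝓘(ℝ, E) x).symm z)) u v :=
  chartMetric_toChart hz.2 u v

variable [FiniteDimensional ℝ E] [FiniteDimensional ℝ E']

/-- The change of coordinates of tangent vectors between two charts. -/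
theorem contDiffAt_coordChange {p q : M'} {z' : E'} (hz' : z' ∈ (extChartAt 𝓘(ℝ, E') p).target)
    (hq : (extChartAt 𝓘(ℝ, E') p).symm z' ∈ (extChartAt 𝓘(ℝ, E') q).source) :
    ContDiffAt ℝ ∞ (fun z' => toChart (E := E') p ((extChartAt 𝓘(ℝ, E') p).symm z') ∘L
      ofChart (E := E') q ((extChartAt 𝓘(ℝ, E') p).symm z')) z' := by
  have hopen : IsOpen ((extChartAt 𝓘(ℝ, E') p).target ∩
      (extChartAt 𝓘(ℝ, E') p).symm ⁻¹' (extChartAt 𝓘(ℝ, E') q).source) :=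
    (continuousOn_extChartAt_symm p).isOpen_inter_preimage (isOpen_target p) (isOpen_source q)
  have hon : ContDiffOn ℝ ∞ (fun z' => toChart (E := E') p ((extChartAt 𝓘(ℝ, E') p).symm z') ∘L
      ofChart (E := E') q ((extChartAt 𝓘(ℝ, E') p).symm z')) ((extChartAt 𝓘(ℝ, E') p).target ∩
      (extChartAt 𝓘(ℝ, E') p).symm ⁻¹' (extChartAt 𝓘(ℝ, E') q).source) := by
    refine contDiffOn_clm_apply.2 fun c w hw => ?_
    have hwp := (extChartAt 𝓘(ℝ, E') p).map_target hw.1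
    have h := (isSmoothFieldAt_iff hwp).1 (isSmoothFieldAt_ofChart hw.2 c)
    rw [(extChartAt 𝓘(ℝ, E') p).right_inv hw.1] at h
    exact h.contDiffWithinAt
  exact (hon z' ⟨hz', hq⟩).contDiffAt (hopen.mem_nhds ⟨hz', hq⟩)

/-- The covariant derivative of a vector field along a map in charts. -/
theorem toChart_covDerivAlong (hg' : IsMetricField g') (hf : ContMDiff 𝓘(ℝ, E) 𝓘(ℝ, E') ∞ f)
    {W : (y : M) → TangentSpace 𝓘(ℝ, E') (f y)}
    (hW : ContMDiff 𝓘(ℝ, E) 𝓘(ℝ, E').tangent ∞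
      (fun y => (⟨f y, W y⟩ : TangentBundle 𝓘(ℝ, E') M')))
    (hy : y ∈ (extChartAt 𝓘(ℝ, E) x).source)
    (hfy : f y ∈ (extChartAt 𝓘(ℝ, E') (f x)).source) (u : TangentSpace 𝓘(ℝ, E) y) :
    toChart (f x) (f y) (covDerivAlong g' f W y u) =
      covAlong (christoffel (chartMetric g' (f x))) (chartMap f x) (chartAlong f x W)
        (extChartAt 𝓘(ℝ, E) x y) (toChart x y u) := by
  have hz := mem_chartDomain hy hfy
  have hfy' := mem_extChartAt_source (I := 𝓘(ℝ, E')) (f y)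
  have hw := contMDiffAt_toChart (p := f y) (hW y) hf.continuous.continuousAt hfy'
  -- `covDerivAlong` at y uses the trivialization centred at f y, while the chart expression uses
  -- the one at f x. Here w is the field in the former and Θ is the change of coordinates to the
  -- latter.
  let w : E → E' := fun z => toChart (f y) (f ((extChartAt 𝓘(ℝ, E) x).symm z))
    (W ((extChartAt 𝓘(ℝ, E) x).symm z))
  let Θ : E' → E' →L[ℝ] E' := fun z' => toChart (f x) ((extChartAt 𝓘(ℝ, E') (f x)).symm z') ∘L
    ofChart (f y) ((extChartAt 𝓘(ℝ, E') (f x)).symm z')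
  have hw0 : w (extChartAt 𝓘(ℝ, E) x y) = toChart (f y) (f y) (W y) := by
    simp only [w]
    rw [(extChartAt 𝓘(ℝ, E) x).left_inv hy]
  have hfz := (extChartAt 𝓘(ℝ, E') (f x)).map_source hfy
  have hfl := (extChartAt 𝓘(ℝ, E') (f x)).left_inv hfy
  have hΘ : HasFDerivAt Θ (fderiv ℝ Θ (extChartAt 𝓘(ℝ, E') (f x) (f y)))
      (extChartAt 𝓘(ℝ, E') (f x) (f y)) :=
    ((contDiffAt_coordChange hfz (by rw [hfl]; exact hfy')).differentiableAt
      (by simp)).hasFDerivAt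
  have hΘ0 : ∀ c, Θ (extChartAt 𝓘(ℝ, E') (f x) (f y)) c
      = toChart (f x) (f y) (ofChart (f y) (f y) c) := by
    intro c
    simp only [Θ]
    rw [hfl]
    rfl
  have hw' : HasFDerivAt w (fderiv ℝ w (extChartAt 𝓘(ℝ, E) x y)) (extChartAt 𝓘(ℝ, E) x y) :=
    ((contDiffAt_comp_symm hy hw).differentiableAt (by simp)).hasFDerivAt
  have hF := ((contDiffAt_chartMap hf hz).differentiableAt (by simp)).hasFDerivAt
  have hF0 := chartMap_apply (E' := E') (f := f) hy
  have hΘ' : HasFDerivAt Θ (fderiv ℝ Θ (extChartAt 𝓘(ℝ, E') (f x) (f y)))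
      (chartMap f x (extChartAt 𝓘(ℝ, E) x y)) := by rw [hF0]; exact hΘ
  -- the vector field along the map
  have hWd : fderiv ℝ (chartAlong f x W) (extChartAt 𝓘(ℝ, E) x y) (toChart x y u) =
      Θ (extChartAt 𝓘(ℝ, E') (f x) (f y)) (fderiv ℝ w (extChartAt 𝓘(ℝ, E) x y) (toChart x y u))
      + fderiv ℝ Θ (extChartAt 𝓘(ℝ, E') (f x) (f y))
        (toChart (f x) (f y) (mfderiv 𝓘(ℝ, E) 𝓘(ℝ, E') f y u)) (toChart (f y) (f y) (W y)) := by
    have hd := (hΘ'.comp _ hF).clm_apply hw'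
    have he : chartAlong f x W =ᶠ[nhds (extChartAt 𝓘(ℝ, E) x y)]
        fun z => Θ (chartMap f x z) (w z) := by
      have hnear : ∀ᶠ z in nhds (extChartAt 𝓘(ℝ, E) x y),
          z ∈ (extChartAt 𝓘(ℝ, E) x).target ∩ (extChartAt 𝓘(ℝ, E) x).symm ⁻¹'
            (f ⁻¹' (extChartAt 𝓘(ℝ, E') (f y)).source) := by
        refine ((continuousOn_extChartAt_symm x).isOpen_inter_preimage (isOpen_target x)
          ((isOpen_source (f y)).preimage hf.continuous)).mem_nhds ⟨hz.1, ?_⟩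
        rw [Set.mem_preimage, (extChartAt 𝓘(ℝ, E) x).left_inv hy]
        exact hfy'
      filter_upwards [(isOpen_chartDomain hf x).mem_nhds hz, hnear] with z hz hz'
      simp only [Θ, w, chartAlong]
      rw [symm_chartMap hz, ContinuousLinearMap.comp_apply, ofChart_toChart hz'.2]
    have hd' : fderiv ℝ (fun z => Θ (chartMap f x z) (w z)) (extChartAt 𝓘(ℝ, E) x y) = _ :=
      hd.fderiv
    rw [he.fderiv_eq, hd']
    simp only [add_apply, ContinuousLinearMap.flip_apply, ContinuousLinearMap.comp_apply,
      Function.comp_apply]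
    rw [hF0, hw0, fderiv_chartMap_toChart hf hy hfy]
  -- the extension of its value
  have hVd : fderiv ℝ (chartField (f x) (locExt (W y))) (extChartAt 𝓘(ℝ, E') (f x) (f y))
        (toChart (f x) (f y) (mfderiv 𝓘(ℝ, E) 𝓘(ℝ, E') f y u)) =
      fderiv ℝ Θ (extChartAt 𝓘(ℝ, E') (f x) (f y))
        (toChart (f x) (f y) (mfderiv 𝓘(ℝ, E) 𝓘(ℝ, E') f y u)) (toChart (f y) (f y) (W y)) := by
    have he : chartField (f x) (locExt (W y)) =ᶠ[nhds (extChartAt 𝓘(ℝ, E') (f x) (f y))]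
        fun z' => Θ z' (toChart (f y) (f y) (W y)) := by
      have hnear : ∀ᶠ z' in nhds (extChartAt 𝓘(ℝ, E') (f x) (f y)),
          z' ∈ (extChartAt 𝓘(ℝ, E') (f x)).target ∩ (extChartAt 𝓘(ℝ, E') (f x)).symm ⁻¹'
            (extChartAt 𝓘(ℝ, E') (f y)).source := by
        refine ((continuousOn_extChartAt_symm (f x)).isOpen_inter_preimage (isOpen_target (f x))
          (isOpen_source (f y))).mem_nhds ⟨hfz, ?_⟩
        rw [Set.mem_preimage, hfl]
        exact hfy'
      filter_upwards [hnear] with z' hz'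
      simp only [Θ, chartField]
      rw [locExt_apply hz'.2]
      rfl
    have hd' : fderiv ℝ (fun z' => Θ z' (toChart (f y) (f y) (W y)))
        (extChartAt 𝓘(ℝ, E') (f x) (f y)) = _ := (hΘ.clm_apply (hasFDerivAt_const _ _)).fderiv
    rw [he.fderiv_eq, hd']
    simp only [add_apply, ContinuousLinearMap.flip_apply, ContinuousLinearMap.comp_apply,
      zero_apply, map_zero, zero_add]
  have hmv : mvfderiv 𝓘(ℝ, E) (fun y' => (trivializationAt E' (TangentSpace 𝓘(ℝ, E')) (f y)
      (⟨f y', W y'⟩ : TangentBundle 𝓘(ℝ, E') M')).2) y u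
      = fderiv ℝ w (extChartAt 𝓘(ℝ, E) x y) (toChart x y u) := by
    have he : (fun y' => (trivializationAt E' (TangentSpace 𝓘(ℝ, E')) (f y)
        (⟨f y', W y'⟩ : TangentBundle 𝓘(ℝ, E') M')).2) =ᶠ[nhds y]
        fun y' => toChart (f y) (f y') (W y') := by
      filter_upwards [hf.continuous.continuousAt.preimage_mem_nhds
        ((isOpen_source (f y)).mem_nhds hfy')] with y' hy'
      exact trivializationAt_snd hy' _
    rw [mvfderiv_eq hy (((hw.congr_of_eventuallyEq he)).mdifferentiableAt (by simp))]
    refine DFunLike.congr_fun (Filter.EventuallyEq.fderiv_eq ?_) _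
    have hcont : ContinuousAt (extChartAt 𝓘(ℝ, E) x).symm (extChartAt 𝓘(ℝ, E) x y) :=
      (contMDiffAt_symm hz.1).continuousAt
    have hl := (extChartAt 𝓘(ℝ, E) x).left_inv hy
    rw [ContinuousAt, hl] at hcont
    filter_upwards [hcont.eventually he] with z hz using hz
  have hcov : covDerivAlong g' f W y u = ofChart (f y) (f y)
      (fderiv ℝ w (extChartAt 𝓘(ℝ, E) x y) (toChart x y u))
      + leviCivita g' (locExt (mfderiv 𝓘(ℝ, E) 𝓘(ℝ, E') f y u)) (locExt (W y)) (f y) := by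
    rw [← hmv, ← trivializationAt_symm hfy']
    rfl
  -- The derivative of Θ appears on both sides: by the product rule in `hWd`, and in `hVd` because
  -- the extension of W y is constant only in the chart at f y. These terms agree.
  rw [hcov, map_add, hg'.toChart_leviCivita hfy (isSmoothFieldAt_locExt hfy' _)
    (isSmoothFieldAt_locExt hfy' _), covDeriv_apply, locExt_self, hVd, covAlong, hWd, hΘ0,
    chartField_apply hfy, locExt_self, hF0, chartAlong_apply hy, fderiv_chartMap_toChart hf hy hfy]
  abel

end ChartMap

/-! ### Restriction of local metrics and smoothness of the shape form. -/

section LocalShape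

variable {E : Type*} [NormedAddCommGroup E] [NormedSpace ℝ E]
  {E' : Type*} [NormedAddCommGroup E'] [NormedSpace ℝ E']
  {G : E → E →L[ℝ] E →L[ℝ] ℝ} {U W : Set E} {z : E}

theorem IsLocalMetric.mono (hG : IsLocalMetric G U) (hW : IsOpen W) (hWU : W ⊆ U) :
    IsLocalMetric G W where
  isOpen := hW
  contDiffOn := hG.contDiffOn.mono hWU
  symm z hz := hG.symm z (hWU hz)
  nondegenerate z hz := hG.nondegenerate z (hWU hz)

variable [FiniteDimensional ℝ E] [FiniteDimensional ℝ E'] {G' : E' → E' →L[ℝ] E' →L[ℝ] ℝ}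
  {U' : Set E'} {F N : E → E'} {ε : ℝ}

theorem IsLocalHypersurface.contDiffAt_shape (h : IsLocalHypersurface G U G' U' F N ε)
    (hz : z ∈ U) (u v : E) :
    ContDiffAt ℝ ∞ (fun z => G' (F z) (covAlong (christoffel G') F N z u) (fderiv ℝ F z v)) z := by
  have hF := h.contDiffAt z hz
  have hFz := h.mapsTo z hz
  have hcov := contDiffAt_covAlong (h.metric'.contDiffAt_christoffel hFz) hF
    (h.contDiffAt_normal z hz) u
  exact (((h.metric'.contDiffAt hFz).comp z hF).clm_apply hcov).clm_apply (h.contDiffAt_fderiv hz v)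

end LocalShape

/-! ### Functions with vanishing differential. -/

section ConstantFunction

variable {E : Type*} [NormedAddCommGroup E] [NormedSpace ℝ E]
  {M : Type*} [TopologicalSpace M] [ChartedSpace E M] [IsManifold 𝓘(ℝ, E) ∞ M]

/-- On a ball inside the chart target the derivative vanishes and the ball is connected, so h is
locally constant; connectedness of M globalizes this. -/
theorem exists_eq_const_of_mvfderiv_eq_zero [ConnectedSpace M] {h : M → ℝ}
    (hh : ContMDiff 𝓘(ℝ, E) 𝓘(ℝ, ℝ) ∞ h)
    (h0 : ∀ (x : M) (u : TangentSpace 𝓘(ℝ, E) x), mvfderiv 𝓘(ℝ, E) h x u = 0) :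
    ∃ a, ∀ x, h x = a := by
  have hloc : IsLocallyConstant h := by
    rw [IsLocallyConstant.iff_eventually_eq]
    intro x
    have hx := mem_extChartAt_source (I := 𝓘(ℝ, E)) x
    have hz := (extChartAt 𝓘(ℝ, E) x).map_source hx
    obtain ⟨r, hr, hball⟩ := Metric.isOpen_iff.1 (isOpen_target x) _ hz
    have hd : ∀ z ∈ Metric.ball (extChartAt 𝓘(ℝ, E) x x) r,
        ContDiffAt ℝ ∞ (fun z => h ((extChartAt 𝓘(ℝ, E) x).symm z)) z := by
      intro z hz
      have hy := (extChartAt 𝓘(ℝ, E) x).map_target (hball hz)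
      have h1 := contDiffAt_comp_symm hy (hh _)
      rwa [(extChartAt 𝓘(ℝ, E) x).right_inv (hball hz)] at h1
    have hf : Set.EqOn (fderiv ℝ (fun z => h ((extChartAt 𝓘(ℝ, E) x).symm z))) 0
        (Metric.ball (extChartAt 𝓘(ℝ, E) x x) r) := by
      intro z hz
      have hy := (extChartAt 𝓘(ℝ, E) x).map_target (hball hz)
      ext a
      have h1 := mvfderiv_eq hy (hh.mdifferentiable (by simp) _)
        (ofChart x ((extChartAt 𝓘(ℝ, E) x).symm z) a)
      rw [h0, (extChartAt 𝓘(ℝ, E) x).right_inv (hball hz), toChart_ofChart hy] at h1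
      exact h1.symm
    obtain ⟨a, ha⟩ := Metric.isOpen_ball.exists_is_const_of_fderiv_eq_zero
      (convex_ball _ _).isPreconnected
      (fun z hz => ((hd z hz).differentiableAt (by simp)).differentiableWithinAt) hf
    have hconst : ∀ y ∈ (extChartAt 𝓘(ℝ, E) x).source,
        extChartAt 𝓘(ℝ, E) x y ∈ Metric.ball (extChartAt 𝓘(ℝ, E) x x) r → h y = a := by
      intro y hy hyb
      have h1 := ha _ hyb
      rwa [(extChartAt 𝓘(ℝ, E) x).left_inv hy] at h1
    filter_upwards [(isOpen_source x).mem_nhds hx,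
      (contMDiffAt_chart hx).continuousAt.preimage_mem_nhds (Metric.ball_mem_nhds _ hr)]
      with y hy hyb
    rw [hconst y hy hyb, hconst x hx (Metric.mem_ball_self hr)]
  obtain ⟨x₀⟩ := (inferInstance : Nonempty M)
  exact ⟨h x₀, fun x => hloc.apply_eq_of_preconnectedSpace x x₀⟩

end ConstantFunction

/-! ### From hypersurfaces in manifolds to hypersurfaces in coordinates. -/

section Hypersurface

variable {E : Type*} [NormedAddCommGroup E] [NormedSpace ℝ E]
  {M : Type*} [TopologicalSpace M] [ChartedSpace E M] [IsManifold 𝓘(ℝ, E) ∞ M]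
  {E' : Type*} [NormedAddCommGroup E'] [NormedSpace ℝ E']
  {M' : Type*} [TopologicalSpace M'] [ChartedSpace E' M'] [IsManifold 𝓘(ℝ, E') ∞ M']

/-- An isometric immersion with a unit normal field. -/
structure IsHypersurface (g : BilinField 𝓘(ℝ, E) M) (g' : BilinField 𝓘(ℝ, E') M') (f : M → M')
    (N : (x : M) → TangentSpace 𝓘(ℝ, E') (f x)) (ε : ℝ) : Prop where
  metric : IsMetricField g
  metric' : IsMetricField g'
  immersion : IsIsometricImmersion g g' f
  normal : IsUnitNormal (I := 𝓘(ℝ, E)) g' f N ε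

/-- The bilinear form `g'(∇'_u N, df(v))`, the negative of `g(𝒜 u, v)`. -/
noncomputable def shapeForm (g' : BilinField 𝓘(ℝ, E') M') (f : M → M')
    (N : (x : M) → TangentSpace 𝓘(ℝ, E') (f x)) (x : M) (u v : TangentSpace 𝓘(ℝ, E) x) : ℝ :=
  g' (f x) (covDerivAlong g' f N x u) (mfderiv 𝓘(ℝ, E) 𝓘(ℝ, E') f x v)

variable {g : BilinField 𝓘(ℝ, E) M} {g' : BilinField 𝓘(ℝ, E') M'} {f : M → M'}
  {N : (x : M) → TangentSpace 𝓘(ℝ, E') (f x)} {ε : ℝ} {x y : M} {z : E}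
  {X : (p : M') → TangentSpace 𝓘(ℝ, E') p} {σ : M' → ℝ}
  [FiniteDimensional ℝ E] [FiniteDimensional ℝ E']

theorem IsConformalField.isLocalConformal (hX : IsConformalField g' X σ) (hg' : IsMetricField g')
    (p : M') : IsLocalConformal (chartMetric g' p) (extChartAt 𝓘(ℝ, E') p).target
      (chartField p X) (fun z => σ ((extChartAt 𝓘(ℝ, E') p).symm z)) where
  contDiffAt z hz := by
    have hy := (extChartAt 𝓘(ℝ, E') p).map_target hz
    have h := (isSmoothFieldAt_iff hy).1 (hX.smooth_field _)
    rwa [(extChartAt 𝓘(ℝ, E') p).right_inv hz] at h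
  contDiffAt_factor z hz := by
    have hy := (extChartAt 𝓘(ℝ, E') p).map_target hz
    have h := contDiffAt_comp_symm hy (hX.smooth_factor _)
    rwa [(extChartAt 𝓘(ℝ, E') p).right_inv hz] at h
  conformal z hz a b := by
    have hy := (extChartAt 𝓘(ℝ, E') p).map_target hz
    have h := hg'.lieDerivMetric_eq hy (hX.smooth_field _)
      (ofChart p ((extChartAt 𝓘(ℝ, E') p).symm z) a) (ofChart p ((extChartAt 𝓘(ℝ, E') p).symm z) b)
    rw [hX.lieDeriv_eq, (extChartAt 𝓘(ℝ, E') p).right_inv hz, toChart_ofChart hy,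
      toChart_ofChart hy] at h
    exact h.symm

namespace IsHypersurface

theorem isLocalHypersurface (h : IsHypersurface g g' f N ε) (x : M) :
    IsLocalHypersurface (chartMetric g x) (chartDomain (E := E) (E' := E') f x)
      (chartMetric g' (f x)) (extChartAt 𝓘(ℝ, E') (f x)).target (chartMap f x)
      (chartAlong f x N) ε where
  metric := (h.metric.isLocalMetric x).mono (isOpen_chartDomain h.immersion.smooth x)
    Set.inter_subset_left
  metric' := h.metric'.isLocalMetric (f x)
  mapsTo _ hz := chartMap_mem hz
  contDiffAt _ hz := contDiffAt_chartMap h.immersion.smooth hz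
  isometric z hz u v := by
    rw [fderiv_chartMap_apply h.immersion.smooth hz, fderiv_chartMap_apply h.immersion.smooth hz,
      chartMetric_chartMap hz, h.immersion.isometric, chartMetric_apply]
  contDiffAt_normal _ hz := contDiffAt_chartAlong h.immersion.smooth h.normal.smooth hz
  sign := by rcases h.normal.sign with h | h <;> simp [h]
  unit z hz := by rw [chartAlong, chartMetric_chartMap hz, h.normal.unit]
  normal z hz u := by
    rw [fderiv_chartMap_apply h.immersion.smooth hz, chartAlong, chartMetric_chartMap hz,
      h.normal.normal]

/-- This is needed away from the centre of the chart as well: the density argument and the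
smoothness of the umbilic factor compare values at nearby points in one fixed chart. -/
theorem shape_eq (h : IsHypersurface g g' f N ε) (hy : y ∈ (extChartAt 𝓘(ℝ, E) x).source)
    (hfy : f y ∈ (extChartAt 𝓘(ℝ, E') (f x)).source) (u v : TangentSpace 𝓘(ℝ, E) y) :
    chartMetric g' (f x) (chartMap f x (extChartAt 𝓘(ℝ, E) x y))
      (covAlong (christoffel (chartMetric g' (f x))) (chartMap f x) (chartAlong f x N)
        (extChartAt 𝓘(ℝ, E) x y) (toChart x y u))
      (fderiv ℝ (chartMap f x) (extChartAt 𝓘(ℝ, E) x y) (toChart x y v)) =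
        shapeForm g' f N y u v := by
  rw [← toChart_covDerivAlong h.metric' h.immersion.smooth h.normal.smooth hy hfy,
    fderiv_chartMap_toChart h.immersion.smooth hy hfy, chartMap_apply hy, chartMetric_toChart hfy,
    shapeForm]

theorem angle_eq (hz : z ∈ chartDomain (E' := E') f x) :
    angle g' f N X ((extChartAt 𝓘(ℝ, E) x).symm z) = chartMetric g' (f x) (chartMap f x z)
      (chartField (f x) X (chartMap f x z)) (chartAlong f x N z) := by
  have key : ∀ p, p = f ((extChartAt 𝓘(ℝ, E) x).symm z) → toChart (f x) p (X p)
      = toChart (f x) (f ((extChartAt 𝓘(ℝ, E) x).symm z))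
        (X (f ((extChartAt 𝓘(ℝ, E) x).symm z))) := by
    rintro _ rfl; rfl
  rw [chartField, key _ (symm_chartMap hz), chartAlong, chartMetric_chartMap hz, angle]

theorem contMDiff_angle (h : IsHypersurface g g' f N ε) (hX : IsSmoothField X) :
    ContMDiff 𝓘(ℝ, E) 𝓘(ℝ, ℝ) ∞ (angle g' f N X) := by
  intro x
  have hz := mem_chartDomain_self (E := E) (E' := E') f x
  have hl := h.isLocalHypersurface x
  refine contMDiffAt_of_comp_symm (mem_extChartAt_source x) ?_
  have hF := hl.contDiffAt _ hz
  have hFz := hl.mapsTo _ hz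
  have hX' : ContDiffAt ℝ ∞ (chartField (f x) X) (chartMap f x (extChartAt 𝓘(ℝ, E) x x)) := by
    rw [chartMap_apply (mem_extChartAt_source x)]
    exact (isSmoothFieldAt_iff (mem_extChartAt_source (f x))).1 (hX (f x))
  refine ((((hl.metric'.contDiffAt hFz).comp _ hF).clm_apply (hX'.comp _ hF)).clm_apply
    (hl.contDiffAt_normal _ hz)).congr_of_eventuallyEq ?_
  filter_upwards [(isOpen_chartDomain h.immersion.smooth x).mem_nhds hz] with z hz
  exact angle_eq hz

end IsHypersurface

end Hypersurface

/-! ### Weingarten operator, tangent part and ambient curvature on the manifold. -/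

section Umbilic

variable {E : Type*} [NormedAddCommGroup E] [NormedSpace ℝ E]
  {M : Type*} [TopologicalSpace M] [ChartedSpace E M] [IsManifold 𝓘(ℝ, E) ∞ M]
  {E' : Type*} [NormedAddCommGroup E'] [NormedSpace ℝ E']
  {M' : Type*} [TopologicalSpace M'] [ChartedSpace E' M'] [IsManifold 𝓘(ℝ, E') ∞ M']
  {g : BilinField 𝓘(ℝ, E) M} {g' : BilinField 𝓘(ℝ, E') M'} {f : M → M'}
  {N : (x : M) → TangentSpace 𝓘(ℝ, E') (f x)} {ε : ℝ} {x y : M} {z : E}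
  {X : (p : M') → TangentSpace 𝓘(ℝ, E') p} {σ : M' → ℝ}
  [FiniteDimensional ℝ E] [FiniteDimensional ℝ E']

namespace IsHypersurface

/-- Since ∇'_u N has no normal component, its pairings with tangent vectors determine it. -/
theorem covDerivAlong_normal_eq (h : IsHypersurface g g' f N ε)
    (hdim : Module.finrank ℝ E' = Module.finrank ℝ E + 1) {a : ℝ}
    (u : TangentSpace 𝓘(ℝ, E) x) (hu : ∀ v, shapeForm g' f N x u v = -(a * g x u v)) :
    covDerivAlong g' f N x u = -(a • mfderiv 𝓘(ℝ, E) 𝓘(ℝ, E') f x u) := by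
  have hx := mem_extChartAt_source (I := 𝓘(ℝ, E)) x
  have hfx := mem_extChartAt_source (I := 𝓘(ℝ, E')) (f x)
  have hz := mem_chartDomain_self (E := E) (E' := E') f x
  have hl := h.isLocalHypersurface x
  refine toChart_injective hfx ?_
  rw [toChart_covDerivAlong h.metric' h.immersion.smooth h.normal.smooth hx hfx, map_neg, map_smul,
    ← fderiv_chartMap_toChart h.immersion.smooth hx hfx]
  refine hl.ext_inner hz hdim (fun w => ?_) ?_
  · have hw := h.shape_eq hx hfx u (ofChart x x w)
    rw [toChart_ofChart hx] at hw
    rw [hw, hu, ← chartMetric_toChart hx, toChart_ofChart hx, ← hl.isometric _ hz]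
    simp only [map_neg, map_smul, neg_apply, smul_apply, smul_eq_mul]
  · rw [hl.inner_covAlong_normal hz, map_neg, map_smul, neg_apply, smul_apply,
      hl.metric'.symm _ (hl.mapsTo _ hz), hl.normal _ hz, smul_zero, neg_zero]

theorem covAlong_normal_eq (h : IsHypersurface g g' f N ε) {α : M → ℝ}
    (hα : ∀ (x : M) (u : TangentSpace 𝓘(ℝ, E) x),
      covDerivAlong g' f N x u = -(α x • mfderiv 𝓘(ℝ, E) 𝓘(ℝ, E') f x u))
    (hz : z ∈ chartDomain (E' := E') f x) (u : E) :
    covAlong (christoffel (chartMetric g' (f x))) (chartMap f x) (chartAlong f x N) z u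
      = -(α ((extChartAt 𝓘(ℝ, E) x).symm z) • fderiv ℝ (chartMap f x) z u) := by
  have hy := (extChartAt 𝓘(ℝ, E) x).map_target hz.1
  have h1 := toChart_covDerivAlong h.metric' h.immersion.smooth h.normal.smooth hy hz.2
    (ofChart x ((extChartAt 𝓘(ℝ, E) x).symm z) u)
  rw [hα, map_neg, map_smul, ← fderiv_chartMap_toChart h.immersion.smooth hy hz.2,
    toChart_ofChart hy, (extChartAt 𝓘(ℝ, E) x).right_inv hz.1] at h1
  exact h1.symm

/-- As ∇'_u N is tangential, it lies in the range of df, so the `Function.invFun` in `weingarten`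
returns a true preimage. -/
theorem inner_weingarten (h : IsHypersurface g g' f N ε)
    (hdim : Module.finrank ℝ E' = Module.finrank ℝ E + 1) (u v : TangentSpace 𝓘(ℝ, E) x) :
    g x (weingarten (I := 𝓘(ℝ, E)) g' f N x u) v = -shapeForm g' f N x u v := by
  have hx := mem_extChartAt_source (I := 𝓘(ℝ, E)) x
  have hfx := mem_extChartAt_source (I := 𝓘(ℝ, E')) (f x)
  have hz := mem_chartDomain_self (E := E) (E' := E') f x
  have hl := h.isLocalHypersurface x
  obtain ⟨w, hw⟩ := hl.exists_covAlong_normal_eq hz hdim (toChart x x u)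
  have hex : ∃ w', mfderiv 𝓘(ℝ, E) 𝓘(ℝ, E') f x w' = -covDerivAlong g' f N x u := by
    refine ⟨-ofChart x x w, toChart_injective hfx ?_⟩
    rw [map_neg, map_neg, map_neg, toChart_covDerivAlong h.metric' h.immersion.smooth
      h.normal.smooth hx hfx, hw, ← fderiv_chartMap_toChart h.immersion.smooth hx hfx,
      toChart_ofChart hx]
  have hd : mfderiv 𝓘(ℝ, E) 𝓘(ℝ, E') f x (weingarten (I := 𝓘(ℝ, E)) g' f N x u)
      = -covDerivAlong g' f N x u := Function.invFun_eq hex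
  rw [← h.immersion.isometric, hd, map_neg, neg_apply, shapeForm]

/-- If the normal coefficient is a, pairing with N gives C = aε, hence a = εC by ε² = 1. -/
theorem mfderiv_tangentPart (h : IsHypersurface g g' f N ε)
    (hdim : Module.finrank ℝ E' = Module.finrank ℝ E + 1) (x : M) :
    X (f x) = mfderiv 𝓘(ℝ, E) 𝓘(ℝ, E') f x (tangentPart g g' f X x)
      + (ε * angle g' f N X x) • N x := by
  have hx := mem_extChartAt_source (I := 𝓘(ℝ, E)) x
  have hfx := mem_extChartAt_source (I := 𝓘(ℝ, E')) (f x)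
  have hz := mem_chartDomain_self (E := E) (E' := E') f x
  have hl := h.isLocalHypersurface x
  obtain ⟨w, a, hw⟩ := hl.exists_decomposition hz hdim (toChart (f x) (f x) (X (f x)))
  have hdec : X (f x) = mfderiv 𝓘(ℝ, E) 𝓘(ℝ, E') f x (ofChart x x w) + a • N x := by
    refine toChart_injective hfx ?_
    rw [hw, map_add, map_smul, ← fderiv_chartMap_toChart h.immersion.smooth hx hfx,
      toChart_ofChart hx, chartAlong_apply hx]
  have hC : angle g' f N X x = a * ε := by
    rw [angle, hdec, map_add, add_apply, h.metric'.symm, h.normal.normal, map_smul, smul_apply,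
      h.normal.unit, zero_add, smul_eq_mul]
  have hV : tangentPart g g' f X x = ofChart x x w := by
    refine h.metric.sharp_eq fun v => ?_
    rw [← h.immersion.isometric]
    rw [hdec, map_add, add_apply, map_smul, smul_apply, h.normal.normal, smul_zero, add_zero]
  have ha : ε * angle g' f N X x = a := by
    have := hl.sign
    rw [hC]; linear_combination a * this
  rw [hV, ha]
  exact hdec

theorem lieDerivMetric_tangentPart (h : IsHypersurface g g' f N ε)
    (hdim : Module.finrank ℝ E' = Module.finrank ℝ E + 1) (hX : IsConformalField g' X σ)
    (hV : IsSmoothField (tangentPart g g' f X)) (u v : TangentSpace 𝓘(ℝ, E) x) :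
    lieDerivMetric g (tangentPart g g' f X) x u v =
      2 * σ (f x) * g x u v - 2 * ε * angle g' f N X x * shapeForm g' f N x u v := by
  have hx := mem_extChartAt_source (I := 𝓘(ℝ, E)) x
  have hfx := mem_extChartAt_source (I := 𝓘(ℝ, E')) (f x)
  have hz := mem_chartDomain_self (E := E) (E' := E') f x
  have hl := h.isLocalHypersurface x
  have hVc := ((isSmoothFieldAt_iff hx).1 (hV x)).differentiableAt (by simp)
  have hC := (contDiffAt_comp_symm hx (h.contMDiff_angle hX.smooth_field x)).differentiableAt
    (by simp)
  have hdec : ∀ᶠ z in nhds (extChartAt 𝓘(ℝ, E) x x), chartField (f x) X (chartMap f x z) =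
      fderiv ℝ (chartMap f x) z (chartField x (tangentPart g g' f X) z)
        + (ε * angle g' f N X ((extChartAt 𝓘(ℝ, E) x).symm z)) • chartAlong f x N z := by
    filter_upwards [(isOpen_chartDomain h.immersion.smooth x).mem_nhds hz] with z hz
    have hy := (extChartAt 𝓘(ℝ, E) x).map_target hz.1
    have key : ∀ p, p = f ((extChartAt 𝓘(ℝ, E) x).symm z) → toChart (f x) p (X p)
        = toChart (f x) (f ((extChartAt 𝓘(ℝ, E) x).symm z))
          (X (f ((extChartAt 𝓘(ℝ, E) x).symm z))) := by
      rintro _ rfl; rfl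
    rw [chartField, key _ (symm_chartMap hz), h.mfderiv_tangentPart (X := X) hdim, map_add,
      map_smul, fderiv_chartMap_apply h.immersion.smooth hz, chartField, ofChart_toChart hy, chartAlong]
  have hcov := hl.covDeriv_tangentPart hz (hX.isLocalConformal h.metric' (f x)) hVc hC hdec
    (toChart x x u) (toChart x x v)
  rw [h.shape_eq hx hfx, chartMetric_toChart hx, (extChartAt 𝓘(ℝ, E) x).left_inv hx,
    chartMap_apply hx, (extChartAt 𝓘(ℝ, E') (f x)).left_inv hfx] at hcov
  rw [h.metric.lieDerivMetric_eq hx (hV x), ← hcov]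
  exact congrArg _ ((h.metric.isLocalMetric x).symm _ hz.1 _ _)

/-- The curvature of an ambient space of constant sectional curvature, along a hypersurface on
which the metric is definite. -/
theorem curvature_ambient (h : IsHypersurface g g' f N ε) [Nontrivial E]
    (hdef : ∀ (x : M) (u : TangentSpace 𝓘(ℝ, E) x), g x u u = 0 → u = 0) {c : ℝ}
    (hc : HasConstantSectionalCurvature g' c) (x : M) (u v w : E') :
    curvatureOf (christoffel (chartMetric g' (f x))) (chartMap f x (extChartAt 𝓘(ℝ, E) x x)) u v w
      = c • (chartMetric g' (f x) (chartMap f x (extChartAt 𝓘(ℝ, E) x x)) v w • u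
        - chartMetric g' (f x) (chartMap f x (extChartAt 𝓘(ℝ, E) x x)) u w • v) := by
  have hx := mem_extChartAt_source (I := 𝓘(ℝ, E)) x
  have hfx := mem_extChartAt_source (I := 𝓘(ℝ, E')) (f x)
  have hz := mem_chartDomain_self (E := E) (E' := E') f x
  have hl := h.isLocalHypersurface x
  obtain ⟨e, he⟩ := exists_ne (0 : E)
  -- The plane of df(e) and N is nondegenerate, with area form ε g(e, e) ≠ 0 by definiteness of g on
  -- M.
  refine hl.metric'.curvature_eq_of_sectional (hl.mapsTo _ hz)
    (u₀ := fderiv ℝ (chartMap f x) (extChartAt 𝓘(ℝ, E) x x) e)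
    (v₀ := chartAlong f x N (extChartAt 𝓘(ℝ, E) x x)) ?_ (fun u v huv => ?_) u v w
  · rw [hl.isometric _ hz, hl.unit _ hz, hl.metric'.symm _ (hl.mapsTo _ hz), hl.normal _ hz]
    have hε : ε ≠ 0 := by
      intro h0; have := hl.sign; simp [h0] at this
    have hg : chartMetric g x (extChartAt 𝓘(ℝ, E) x x) e e ≠ 0 := by
      intro h0
      have h1 := chartMetric_toChart (g := g) hx (ofChart x x e) (ofChart x x e)
      rw [toChart_ofChart hx, h0] at h1
      have h2 := congrArg (toChart x x) (hdef x _ h1.symm)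
      rw [toChart_ofChart hx, map_zero] at h2
      exact he h2
    simpa using ⟨hg, hε⟩
  · rw [chartMap_apply hx] at huv ⊢
    have hm : ∀ a b : E', chartMetric g' (f x) (extChartAt 𝓘(ℝ, E') (f x) (f x)) a b
        = g' (f x) (ofChart (f x) (f x) a) (ofChart (f x) (f x) b) := by
      intro a b
      rw [← chartMetric_toChart hfx, toChart_ofChart hfx, toChart_ofChart hfx]
    rw [hm, hm, hm] at huv ⊢
    have h1 := hc (f x) (ofChart (f x) (f x) u) (ofChart (f x) (f x) v) huv
    rw [sectionalCurvature, areaForm, div_eq_iff huv] at h1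
    have h2 := h.metric'.toChart_curvature (f x) (ofChart (f x) (f x) u) (ofChart (f x) (f x) v)
      (ofChart (f x) (f x) v)
    rw [toChart_ofChart hfx, toChart_ofChart hfx] at h2
    rw [← h2, hm, ofChart_toChart hfx, h1]

end IsHypersurface

end Umbilic

/-! ### Umbilicity, constancy of the principal curvature, and the angle function. -/

section Concircular

variable {E : Type*} [NormedAddCommGroup E] [NormedSpace ℝ E]
  {M : Type*} [TopologicalSpace M] [ChartedSpace E M] [IsManifold 𝓘(ℝ, E) ∞ M]
  {E' : Type*} [NormedAddCommGroup E'] [NormedSpace ℝ E']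
  {M' : Type*} [TopologicalSpace M'] [ChartedSpace E' M'] [IsManifold 𝓘(ℝ, E') ∞ M']
  {g : BilinField 𝓘(ℝ, E) M} {g' : BilinField 𝓘(ℝ, E') M'} {f : M → M'}
  {N : (x : M) → TangentSpace 𝓘(ℝ, E') (f x)} {ε : ℝ} {x y : M} {z : E}
  {X : (p : M') → TangentSpace 𝓘(ℝ, E') p} {σ : M' → ℝ}
  [FiniteDimensional ℝ E] [FiniteDimensional ℝ E']

namespace IsHypersurface

/-- Where ψ ≠ 0, multiply by ψ: replacing each ψ g by m S makes both sides m S(u, v) S(w, w). Both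
sides are continuous in a chart, so a failure at x would persist nearby and meet the dense set. No
regularity of m or ψ is needed. -/
theorem shapeForm_mul_eq (h : IsHypersurface g g' f N ε) {ψ m : M → ℝ}
    (hψ : Dense {x | ψ x ≠ 0})
    (hm : ∀ (x : M) (u v : TangentSpace 𝓘(ℝ, E) x),
      m x * shapeForm g' f N x u v = ψ x * g x u v)
    (u v w : TangentSpace 𝓘(ℝ, E) x) :
    shapeForm g' f N x u v * g x w w = shapeForm g' f N x w w * g x u v := by
  have hx := mem_extChartAt_source (I := 𝓘(ℝ, E)) x
  have hfx := mem_extChartAt_source (I := 𝓘(ℝ, E')) (f x)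
  have hz := mem_chartDomain_self (E := E) (E' := E') f x
  have hl := h.isLocalHypersurface x
  let S : E → E → E → ℝ := fun a b z => chartMetric g' (f x) (chartMap f x z)
    (covAlong (christoffel (chartMetric g' (f x))) (chartMap f x) (chartAlong f x N) z a)
    (fderiv ℝ (chartMap f x) z b)
  let D : E → ℝ := fun z =>
    S (toChart x x u) (toChart x x v) z * chartMetric g x z (toChart x x w) (toChart x x w)
      - S (toChart x x w) (toChart x x w) z * chartMetric g x z (toChart x x u) (toChart x x v)
  have hS : ∀ a b, ContinuousAt (S a b) (extChartAt 𝓘(ℝ, E) x x) := fun a b =>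
    (hl.contDiffAt_shape hz a b).continuousAt
  have hG : ∀ a b : E, ContinuousAt (fun z => chartMetric g x z a b) (extChartAt 𝓘(ℝ, E) x x) :=
    fun a b => (((hl.metric.contDiffAt hz).clm_apply contDiffAt_const).clm_apply
      contDiffAt_const).continuousAt
  have hD : ContinuousAt D (extChartAt 𝓘(ℝ, E) x x) :=
    ((hS _ _).mul (hG _ _)).sub ((hS _ _).mul (hG _ _))
  have hval : D (extChartAt 𝓘(ℝ, E) x x) = shapeForm g' f N x u v * g x w w
      - shapeForm g' f N x w w * g x u v := by
    simp only [D, S]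
    rw [h.shape_eq hx hfx, h.shape_eq hx hfx, chartMetric_toChart hx, chartMetric_toChart hx]
  by_contra hne
  have hD0 : D (extChartAt 𝓘(ℝ, E) x x) ≠ 0 := by rwa [hval, sub_ne_zero]
  have hev : ∀ᶠ y in nhds x, D (extChartAt 𝓘(ℝ, E) x y) ≠ 0 :=
    (ContinuousAt.comp (f := extChartAt 𝓘(ℝ, E) x) hD
      (contMDiffAt_chart hx).continuousAt).eventually_ne hD0
  obtain ⟨y, hy0, ⟨hyD, hy⟩, hfy⟩ := hψ.inter_nhds_nonempty (Filter.inter_mem (Filter.inter_mem hev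
    ((isOpen_source x).mem_nhds hx)) (h.immersion.smooth.continuous.continuousAt.preimage_mem_nhds
      ((isOpen_source (f x)).mem_nhds hfx)))
  refine hyD ?_
  have hS' : ∀ a b : E, S a b (extChartAt 𝓘(ℝ, E) x y)
      = shapeForm g' f N y (ofChart x y a) (ofChart x y b) := by
    intro a b
    rw [← h.shape_eq hy hfy, toChart_ofChart hy, toChart_ofChart hy]
  have hG' : ∀ a b : E, chartMetric g x (extChartAt 𝓘(ℝ, E) x y) a b
      = g y (ofChart x y a) (ofChart x y b) := by
    intro a b
    rw [← chartMetric_toChart hy, toChart_ofChart hy, toChart_ofChart hy]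
  simp only [D, hS', hG']
  refine mul_left_cancel₀ (a := ψ y) hy0 ?_
  rw [mul_zero, mul_sub, mul_left_comm, ← hm, mul_left_comm (ψ y), ← hm]
  ring

/-- In a fixed chart α equals -S(e, e)/g(e, e) for a constant coordinate vector e ≠ 0; definiteness
keeps the denominator nonzero. -/
theorem contMDiff_umbilic_factor (h : IsHypersurface g g' f N ε) [Nontrivial E]
    (hdef : ∀ (x : M) (u : TangentSpace 𝓘(ℝ, E) x), g x u u = 0 → u = 0) {α : M → ℝ}
    (hα : ∀ (x : M) (u v : TangentSpace 𝓘(ℝ, E) x), shapeForm g' f N x u v = -(α x * g x u v)) :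
    ContMDiff 𝓘(ℝ, E) 𝓘(ℝ, ℝ) ∞ α := by
  intro x
  have hz := mem_chartDomain_self (E := E) (E' := E') f x
  have hl := h.isLocalHypersurface x
  obtain ⟨e, he⟩ := exists_ne (0 : E)
  have hne : ∀ z ∈ chartDomain (E' := E') f x, chartMetric g x z e e ≠ 0 := by
    intro z hz h0
    have hy := (extChartAt 𝓘(ℝ, E) x).map_target hz.1
    have h2 := congrArg (toChart x _) (hdef _ (ofChart x _ e) h0)
    rw [toChart_ofChart hy, map_zero] at h2
    exact he h2
  refine contMDiffAt_of_comp_symm (mem_extChartAt_source x) ?_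
  refine (((hl.contDiffAt_shape hz e e).neg).div (((hl.metric.contDiffAt hz).clm_apply
    contDiffAt_const).clm_apply contDiffAt_const) (hne _ hz)).congr_of_eventuallyEq ?_
  filter_upwards [(isOpen_chartDomain h.immersion.smooth x).mem_nhds hz] with z hz
  have hy := (extChartAt 𝓘(ℝ, E) x).map_target hz.1
  have h1 := h.shape_eq hy hz.2 (ofChart x _ e) (ofChart x _ e)
  rw [hα, ← chartMetric_apply, toChart_ofChart hy, (extChartAt 𝓘(ℝ, E) x).right_inv hz.1] at h1
  rw [Pi.div_apply, eq_div_iff (hne z hz), h1, neg_neg]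

/-- A totally umbilic hypersurface of a space of constant curvature has constant principal
curvature. -/
theorem exists_umbilic_const (h : IsHypersurface g g' f N ε) [ConnectedSpace M]
    (hdim : Module.finrank ℝ E' = Module.finrank ℝ E + 1) (hdim2 : 2 ≤ Module.finrank ℝ E)
    (hdef : ∀ (x : M) (u : TangentSpace 𝓘(ℝ, E) x), g x u u = 0 → u = 0) {c : ℝ}
    (hc : HasConstantSectionalCurvature g' c)
    (hS : ∀ (x : M) (u v w : TangentSpace 𝓘(ℝ, E) x),
      shapeForm g' f N x u v * g x w w = shapeForm g' f N x w w * g x u v) :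
    ∃ a : ℝ, ∀ (x : M) (u : TangentSpace 𝓘(ℝ, E) x),
      covDerivAlong g' f N x u = -(a • mfderiv 𝓘(ℝ, E) 𝓘(ℝ, E') f x u) := by
  have : Nontrivial E := Module.nontrivial_of_finrank_pos (R := ℝ) (by lia)
  obtain ⟨e, he⟩ := exists_ne (0 : E)
  let w : (x : M) → TangentSpace 𝓘(ℝ, E) x := fun x => ofChart x x e
  have hw : ∀ x, g x (w x) (w x) ≠ 0 := by
    intro x h0
    have h2 := congrArg (toChart x x) (hdef _ _ h0)
    rw [toChart_ofChart (mem_extChartAt_source x), map_zero] at h2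
    exact he h2
  -- The vectors w x come from a different chart at each point and need not vary continuously.
  -- Smoothness of α comes afterwards from `contMDiff_umbilic_factor`, as umbilicity makes the
  -- quotient independent of the vector.
  let α : M → ℝ := fun x => -(shapeForm g' f N x (w x) (w x) / g x (w x) (w x))
  have hα : ∀ (x : M) (u v : TangentSpace 𝓘(ℝ, E) x),
      shapeForm g' f N x u v = -(α x * g x u v) := by
    intro x u v
    simp only [α, neg_mul, neg_neg]
    rw [div_mul_eq_mul_div, eq_div_iff (hw x), hS]
  have hcov := fun (x : M) (u : TangentSpace 𝓘(ℝ, E) x) => h.covDerivAlong_normal_eq hdim u (hα x u)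
  have hαs := h.contMDiff_umbilic_factor hdef hα
  obtain ⟨a, ha⟩ := exists_eq_const_of_mvfderiv_eq_zero hαs fun x u => by
    have hx := mem_extChartAt_source (I := 𝓘(ℝ, E)) x
    have hz := mem_chartDomain_self (E := E) (E' := E') f x
    rw [mvfderiv_eq hx (hαs.mdifferentiable (by simp) _)]
    refine (h.isLocalHypersurface x).fderiv_umbilic_factor hz hdim2
      (h.curvature_ambient hdef hc x) ?_
      ((contDiffAt_comp_symm hx (hαs x)).differentiableAt (by simp)) _
    filter_upwards [(isOpen_chartDomain h.immersion.smooth x).mem_nhds hz] with z hz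
    exact h.covAlong_normal_eq hcov hz
  exact ⟨a, fun x u => by rw [hcov, ha]⟩

/-- The Hessian of the angle function of a totally umbilic hypersurface. -/
theorem hess_angle (h : IsHypersurface g g' f N ε) [Nontrivial E]
    (hdim : Module.finrank ℝ E' = Module.finrank ℝ E + 1)
    (hdef : ∀ (x : M) (u : TangentSpace 𝓘(ℝ, E) x), g x u u = 0 → u = 0) {c a : ℝ}
    (hc : HasConstantSectionalCurvature g' c)
    (ha : ∀ (x : M) (u : TangentSpace 𝓘(ℝ, E) x),
      covDerivAlong g' f N x u = -(a • mfderiv 𝓘(ℝ, E) 𝓘(ℝ, E') f x u))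
    (hX : IsConformalField g' X σ) (x : M) (u v : TangentSpace 𝓘(ℝ, E) x) :
    hess g (angle g' f N X) x u v = -(mvfderiv 𝓘(ℝ, E') σ (f x) (N x) + a * σ (f x)
      + (c + ε * a ^ 2) * angle g' f N X x) * g x u v := by
  have hx := mem_extChartAt_source (I := 𝓘(ℝ, E)) x
  have hfx := mem_extChartAt_source (I := 𝓘(ℝ, E')) (f x)
  have hz := mem_chartDomain_self (E := E) (E' := E') f x
  have hl := h.isLocalHypersurface x
  have hα : ∀ᶠ z in nhds (extChartAt 𝓘(ℝ, E) x x), ∀ u,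
      covAlong (christoffel (chartMetric g' (f x))) (chartMap f x) (chartAlong f x N) z u
        = -(a • fderiv ℝ (chartMap f x) z u) := by
    filter_upwards [(isOpen_chartDomain h.immersion.smooth x).mem_nhds hz] with z hz
    exact h.covAlong_normal_eq (α := fun _ => a) ha hz
  have hC : (fun z => angle g' f N X ((extChartAt 𝓘(ℝ, E) x).symm z))
      =ᶠ[nhds (extChartAt 𝓘(ℝ, E) x x)] fun z => chartMetric g' (f x) (chartMap f x z)
        (chartField (f x) X (chartMap f x z)) (chartAlong f x N z) := by
    filter_upwards [(isOpen_chartDomain h.immersion.smooth x).mem_nhds hz] with z hz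
    exact angle_eq hz
  have hmain := hl.hessian_angle hz hdim (h.curvature_ambient hdef hc x) hα
    (hX.isLocalConformal h.metric' (f x)) (toChart x x u) (toChart x x v)
  have h2 : (fun z => fderiv ℝ (fun z => angle g' f N X ((extChartAt 𝓘(ℝ, E) x).symm z)) z
      (toChart x x v)) =ᶠ[nhds (extChartAt 𝓘(ℝ, E) x x)] fun z => fderiv ℝ (fun z =>
        chartMetric g' (f x) (chartMap f x z) (chartField (f x) X (chartMap f x z))
          (chartAlong f x N z)) z (toChart x x v) := by
    filter_upwards [hC.fderiv (𝕜 := ℝ)] with z hz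
    rw [hz]
  rw [h.metric.hess_eq_fderiv hx (h.contMDiff_angle hX.smooth_field), h2.fderiv_eq, hC.fderiv_eq,
    hmain, chartMetric_toChart hx, ← angle_eq hz, (extChartAt 𝓘(ℝ, E) x).left_inv hx,
    mvfderiv_eq hfx (hX.smooth_factor.mdifferentiable (by simp) _), chartAlong_apply hx,
    chartMap_apply hx, (extChartAt 𝓘(ℝ, E') (f x)).left_inv hfx]

theorem contMDiff_mvfderiv_normal (h : IsHypersurface g g' f N ε)
    (hσ : ContMDiff 𝓘(ℝ, E') 𝓘(ℝ, ℝ) ∞ σ) :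
    ContMDiff 𝓘(ℝ, E) 𝓘(ℝ, ℝ) ∞ fun x => mvfderiv 𝓘(ℝ, E') σ (f x) (N x) := by
  intro x
  have hx := mem_extChartAt_source (I := 𝓘(ℝ, E)) x
  have hfx := mem_extChartAt_source (I := 𝓘(ℝ, E')) (f x)
  have hz := mem_chartDomain_self (E := E) (E' := E') f x
  have hl := h.isLocalHypersurface x
  refine contMDiffAt_of_comp_symm hx ?_
  have h1 := (contDiffAt_comp_symm hfx (hσ (f x))).fderiv_right (m := ∞) (by simp)
  rw [← chartMap_apply hx] at h1
  refine ((h1.comp _ (hl.contDiffAt _ hz)).clm_apply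
    (hl.contDiffAt_normal _ hz)).congr_of_eventuallyEq ?_
  filter_upwards [(isOpen_chartDomain h.immersion.smooth x).mem_nhds hz] with z hz
  rw [mvfderiv_eq hz.2 (hσ.mdifferentiable (by simp) _)]
  rfl

/-- The angle function of a conformal field on a totally umbilic hypersurface of a space of
constant curvature is a special scalar concircular field. -/
theorem isSpecialScalarConcircular_angle (h : IsHypersurface g g' f N ε) [ConnectedSpace M]
    (hdim : Module.finrank ℝ E' = Module.finrank ℝ E + 1) (hdim2 : 2 ≤ Module.finrank ℝ E)
    (hdef : ∀ (x : M) (u : TangentSpace 𝓘(ℝ, E) x), g x u u = 0 → u = 0) {c a : ℝ}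
    (hc : HasConstantSectionalCurvature g' c)
    (ha : ∀ (x : M) (u : TangentSpace 𝓘(ℝ, E) x),
      covDerivAlong g' f N x u = -(a • mfderiv 𝓘(ℝ, E) 𝓘(ℝ, E') f x u))
    (hX : IsConformalField g' X σ) : IsSpecialScalarConcircular g (angle g' f N X) := by
  have : Nontrivial E := Module.nontrivial_of_finrank_pos (R := ℝ) (by lia)
  have hC := h.contMDiff_angle hX.smooth_field
  let φ : M → ℝ := fun x => -(mvfderiv 𝓘(ℝ, E') σ (f x) (N x) + a * σ (f x)
    + (c + ε * a ^ 2) * angle g' f N X x)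
  have hhess : ∀ (x : M) (u v : TangentSpace 𝓘(ℝ, E) x),
      hess g (angle g' f N X) x u v = φ x * g x u v := h.hess_angle hdim hdef hc ha hX
  have hφ : ContMDiff 𝓘(ℝ, E) 𝓘(ℝ, ℝ) ∞ φ :=
    (((h.contMDiff_mvfderiv_normal hX.smooth_factor).add
      (contMDiff_const.mul (hX.smooth_factor.comp h.immersion.smooth))).add
      (contMDiff_const.mul hC)).neg
  have hsum : ContMDiff 𝓘(ℝ, E) 𝓘(ℝ, ℝ) ∞
      fun x => φ x + (c + ε * a ^ 2) * angle g' f N X x := hφ.add (contMDiff_const.mul hC)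
  -- The constant b is the value of φ + kC with k = c + εa², once d(φ + kC) = 0 is known.
  obtain ⟨b, hb⟩ := exists_eq_const_of_mvfderiv_eq_zero hsum fun x u => by
    have hx := mem_extChartAt_source (I := 𝓘(ℝ, E)) x
    have hz := mem_chartDomain_self (E := E) (E' := E') f x
    have hl := h.isLocalHypersurface x
    have hG := h.metric.isLocalMetric x
    have hα : ∀ᶠ z in nhds (extChartAt 𝓘(ℝ, E) x x), ∀ u,
        covAlong (christoffel (chartMetric g' (f x))) (chartMap f x) (chartAlong f x N) z u
          = -(a • fderiv ℝ (chartMap f x) z u) := by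
      filter_upwards [(isOpen_chartDomain h.immersion.smooth x).mem_nhds hz] with z hz
      exact h.covAlong_normal_eq (α := fun _ => a) ha hz
    have hR := hl.curvature_of_umbilic hz hdim (h.curvature_ambient hdef hc x) hα
    -- Raising an index in Hess C = φ g gives ∇ grad C = φ Id near x. Constant curvature k of M then
    -- yields dφ = -k dC.
    have hcov : ∀ᶠ z in nhds (extChartAt 𝓘(ℝ, E) x x), ∀ u,
        covDeriv (christoffel (chartMetric g x)) (chartField x (grad g (angle g' f N X))) z u
          = φ ((extChartAt 𝓘(ℝ, E) x).symm z) • u := by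
      filter_upwards [hG.eventually_mem hz.1] with z hz u
      have hy := (extChartAt 𝓘(ℝ, E) x).map_target hz
      refine hG.eq_of_forall hz fun v => ?_
      have h1 := h.metric.hess_eq hy hC (ofChart x _ u) (ofChart x _ v)
      rw [hhess, ← chartMetric_apply, toChart_ofChart hy, toChart_ofChart hy,
        (extChartAt 𝓘(ℝ, E) x).right_inv hz] at h1
      rw [← h1, map_smul, smul_apply, smul_eq_mul]
    have hφd := (contDiffAt_comp_symm hx (hφ x)).differentiableAt (by simp)
    have hCd := (contDiffAt_comp_symm hx (hC x)).differentiableAt (by simp)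
    have h1 := fderiv_of_covDeriv_eq_smul hG hz.1 hdim2 hR
      (h.metric.contDiffAt_chartField_grad hz.1 hC) hφd hcov (toChart x x u)
    rw [h.metric.chartField_grad hz.1 (hC.mdifferentiable (by simp) _), hG.apply_inverse hz.1] at h1
    have h2 : fderiv ℝ (fun z => φ ((extChartAt 𝓘(ℝ, E) x).symm z)
        + (c + ε * a ^ 2) * angle g' f N X ((extChartAt 𝓘(ℝ, E) x).symm z))
        (extChartAt 𝓘(ℝ, E) x x) = _ :=
      (hφd.hasFDerivAt.add (hCd.hasFDerivAt.const_mul (c + ε * a ^ 2))).fderiv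
    rw [mvfderiv_eq hx (hsum.mdifferentiable (by simp) _), h2, add_apply, h1, smul_apply,
      smul_eq_mul]
    ring
  refine ⟨hC, c + ε * a ^ 2, b, fun x u v => ?_⟩
  rw [hhess, ← hb x]
  ring

end IsHypersurface

end Concircular

/-! ### Semi-Riemannian and Riemannian metrics as metric fields. -/

section Metrics

variable {E : Type*} [NormedAddCommGroup E] [NormedSpace ℝ E]
  {M : Type*} [TopologicalSpace M] [ChartedSpace E M] [IsManifold 𝓘(ℝ, E) ∞ M]

theorem SemiRiemannianMetric.isMetricField (g : SemiRiemannianMetric 𝓘(ℝ, E) M) :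
    IsMetricField g.val where
  symm := g.symm
  nondegenerate := g.nondegenerate
  smooth X Y y hX hY := by
    have h := ContMDiffAt.clm_bundle_apply₂ (F₁ := E) (F₂ := E) (F₃ := ℝ)
      (E₃ := Bundle.Trivial M ℝ) (g.contMDiff y) hX hY
    exact (Bundle.contMDiffAt_totalSpace.1 h).2

variable [RiemannianBundle (fun x : M => TangentSpace 𝓘(ℝ, E) x)]

theorem eq_zero_of_riemannianForm_eq_zero {x : M} {u : TangentSpace 𝓘(ℝ, E) x}
    (h : riemannianForm 𝓘(ℝ, E) M x u u = 0) : u = 0 :=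
  inner_self_eq_zero.1 h

theorem isMetricField_riemannianForm
    [IsContMDiffRiemannianBundle 𝓘(ℝ, E) ∞ E (fun x : M => TangentSpace 𝓘(ℝ, E) x)] :
    IsMetricField (riemannianForm 𝓘(ℝ, E) M) where
  symm _ u v := real_inner_comm v u
  nondegenerate _ u h := eq_zero_of_riemannianForm_eq_zero (h u)
  smooth _ _ _ hX hY := ContMDiffAt.inner_bundle (F := E)
    (E := fun x : M => TangentSpace 𝓘(ℝ, E) x) hX hY

end Metrics

end RicciSoliton

/-! ### The theorem. -/

theorem theorem2
    -- the dimensions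
    {n : ℕ} (hn : 2 ≤ n)
    -- the complete connected Riemannian manifold `M` of dimension `n`
    {M : Type*} [MetricSpace M] [ChartedSpace (EuclideanSpace ℝ (Fin n)) M]
    [IsManifold (𝓡 n) ∞ M] [RiemannianBundle (fun x : M => TangentSpace (𝓡 n) x)]
    [IsContMDiffRiemannianBundle (𝓡 n) ∞ (EuclideanSpace ℝ (Fin n))
      (fun x : M => TangentSpace (𝓡 n) x)]
    [IsRiemannianManifold (𝓡 n) M] [CompleteSpace M] [ConnectedSpace M]
    -- the semi-Riemannian manifold `M'` of dimension `n + 1` and constant sectional curvature `c`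
    {M' : Type*} [TopologicalSpace M'] [T2Space M'] [SecondCountableTopology M']
    [ChartedSpace (EuclideanSpace ℝ (Fin (n + 1))) M'] [IsManifold (𝓡 (n + 1)) ∞ M']
    (g' : RicciSoliton.SemiRiemannianMetric (𝓡 (n + 1)) M') (c : ℝ)
    (hc : RicciSoliton.HasConstantSectionalCurvature g'.val c)
    -- the isometric immersion `f` and its unit normal field `N`
    (f : M → M')
    (hf : RicciSoliton.IsIsometricImmersion (RicciSoliton.riemannianForm (𝓡 n) M) g'.val f)
    (N : (x : M) → TangentSpace (𝓡 (n + 1)) (f x)) (ε : ℝ)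
    (hN : RicciSoliton.IsUnitNormal (I := 𝓡 n) g'.val f N ε)
    -- the conformal field with its conformal factor
    (X : (y : M') → TangentSpace (𝓡 (n + 1)) y) (σ : M' → ℝ)
    (hX : RicciSoliton.IsConformalField g'.val X σ)
    -- its tangent part defines a Ricci almost soliton with soliton function `lam`
    (lam : M → ℝ)
    (hsol : RicciSoliton.IsRicciAlmostSoliton (RicciSoliton.riemannianForm (𝓡 n) M)
      (RicciSoliton.tangentPart (RicciSoliton.riemannianForm (𝓡 n) M) g'.val f X) lam)
    -- `ψ = σ|_M - lam` is nonzero on a dense set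
    (hψ : Dense {x : M | σ (f x) - lam x ≠ 0})
    -- `Ric = μ 𝒜`
    (μ : M → ℝ) (hμ : ContMDiff (𝓡 n) 𝓘(ℝ, ℝ) ∞ μ)
    (hRic : ∀ (x : M) (u v : TangentSpace (𝓡 n) x),
      RicciSoliton.ricci (RicciSoliton.riemannianForm (𝓡 n) M) x u v =
        μ x * RicciSoliton.riemannianForm (𝓡 n) M x
          (RicciSoliton.weingarten g'.val f N x u) v) :
    RicciSoliton.IsSpecialScalarConcircular (RicciSoliton.riemannianForm (𝓡 n) M)
      (RicciSoliton.angle g'.val f N X) := by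
  have h : RicciSoliton.IsHypersurface (RicciSoliton.riemannianForm (𝓡 n) M) g'.val f N ε :=
    ⟨RicciSoliton.isMetricField_riemannianForm, g'.isMetricField, hf, hN⟩
  have hdef : ∀ (x : M) (u : TangentSpace (𝓡 n) x),
      RicciSoliton.riemannianForm (𝓡 n) M x u u = 0 → u = 0 :=
    fun _ _ => RicciSoliton.eq_zero_of_riemannianForm_eq_zero
  have hdim : Module.finrank ℝ (EuclideanSpace ℝ (Fin (n + 1)))
      = Module.finrank ℝ (EuclideanSpace ℝ (Fin n)) + 1 := by simp
  have hdim2 : 2 ≤ Module.finrank ℝ (EuclideanSpace ℝ (Fin n)) := by simpa using hn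
  -- The soliton equation after substituting Ric = -μ S and ½ L_V g = σ g - εC S.
  have hm : ∀ (x : M) (u v : TangentSpace (𝓡 n) x),
      (μ x + ε * RicciSoliton.angle g'.val f N X x) * RicciSoliton.shapeForm g'.val f N x u v
        = (σ (f x) - lam x) * RicciSoliton.riemannianForm (𝓡 n) M x u v := by
    intro x u v
    have h1 := hsol.soliton_eq x u v
    rw [hRic, h.inner_weingarten hdim, h.lieDerivMetric_tangentPart hdim hX hsol.smooth_field] at h1
    linear_combination -h1
  obtain ⟨a, ha⟩ := h.exists_umbilic_const hdim hdim2 hdef hc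
    fun x u v w => h.shapeForm_mul_eq hψ hm u v w
  exact h.isSpecialScalarConcircular_angle hdim hdim2 hdef hc ha hX
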